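/- Let $q\ge 2$ be an integer, and let $H_q(x)=(-1)^q e^{x^2/2}\frac{d^q}{dx^q}e^{-x^2/2}$ be the $q$th Hermite polynomial. There is a constant $C>0$, depending only on $q$, for which the following holds. Let $(X_k)_{k\in\mathbb Z}$ be a centered stationary Gaussian sequence with unit variance and covariance function $\rho$, i.e. $E[X_kX_l]=\rho(k-l)$ and $\rho(0)=1$, and assume $\rho\in\ell^q(\mathbb Z)$. For $n\ge 1$ put $$V_n=\frac1{\sqrt n}\sum_{k=0}^{n-1}H_q(X_k),\qquad v_n=E[V_n^2],\qquad F_n=\frac{V_n}{\sqrt{v_n}},$$ and let $\kappa_4(F_n)=(-i)^4\frac{d^4}{dt^4}\log E[e^{itF_n}]\big|_{t=0}$ be the fourth cumulant of $F_n$. Then $v_n>0$ for every $n\ge1$ (so that $F_n$ is well defined), and: 1. For all $n\ge 1$, $$\kappa_4(F_n)\le\begin{cases}\dfrac{C}{v_n^2\,n}\Big(\sum_{|k|<n}|\rho(k)|^{2q/3}\Big)^3&\text{if } q\le 3,\\[2ex]\dfrac{C}{v_n^2\,n}\Big(\sum_{|k|<n}|\rho(k)|^{q-1}\Big)^2\Big(\sum_{|k|<n}|\rho(k)|^2\Big)&\text{if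 } q\ge 3.\end{cases}$$ 2. If $q=2$ and $\rho\in\ell^{4/3}(\mathbb Z)$, then the series $g_1(t)=\sum_{k\in\mathbb Z}\rho(k)e^{ikt}$ converges in $L^2(\mathbb T)$, $\mathbb T=\mathbb R/2\pi\mathbb Z$; its sum $g_1$ is real and nonnegative almost everywhere on $\mathbb T$, $\int_{\mathbb T}g_1^2\,dt>0$, $\int_{\mathbb T}g_1^4\,dt<\infty$ (where $dt$ is Lebesgue measure, of total mass $2\pi$), and $$n\,\kappa_4(F_n)\longrightarrow 24\pi\,\frac{\int_{\mathbb T}g_1(t)^4\,dt}{\left(\int_{\mathbb T}g_1(t)^2\,dt\right)^2}\qquad\text{as } n\to\infty.$$ 3. If $q\ge 3$ and $\rho\in\ell^2(\mathbb Z)$, then $\liminf_{n\to\infty}n\,\kappa_4(F_n)>0$ (the value $+\infty$ being allowed). -/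

import Mathlib

open MeasureTheory ProbabilityTheory Filter Topology
open scoped ENNReal

noncomputable section

namespace BreuerMajor

/-- A centered stationary Gaussian sequence `(X_k)_{k ∈ ℤ}` on the probability space `(Ω, P)`, with
unit variance and covariance function `ρ`: `E[X_k X_l] = ρ (k - l)`, `ρ 0 = 1`. For a centered
Gaussian process this form of the covariance is the same as stationarity. -/
structure IsStationaryGaussianSeq {Ω : Type*} [MeasurableSpace Ω] (P : Measure Ω)
    (X : ℤ → Ω → ℝ) (ρ : ℤ → ℝ) : Prop where
  gaussian : IsGaussianProcess X P
  centered : ∀ k, ∫ ω, X k ω ∂P = 0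
  cov_eq : ∀ k l, ∫ ω, X k ω * X l ω ∂P = ρ (k - l)
  unit_variance : ρ 0 = 1

/-- The `j`-th cumulant `κ_j(F) = (-i)^j (d^j/dt^j) log φ_F(t) |_{t = 0}` of a real random
variable `F` with `E|F|^j < ∞`, where `φ_F(t) = E[exp(i t F)]`. The number is then real, which is
why the real part is taken. The principal logarithm is smooth near `φ_F(0) = 1`. -/
def cumulant {Ω : Type*} [MeasurableSpace Ω] (P : Measure Ω) (F : Ω → ℝ) (j : ℕ) : ℝ :=
  ((-Complex.I) ^ j *
    iteratedDeriv j (fun t : ℝ => Complex.log (charFun (P.map F) t)) 0).re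

section Sums

variable {Ω : Type*} [MeasurableSpace Ω]

/-- `V_n = n^{-1/2} ∑_{k=0}^{n-1} H_q(X_k)`, where `H_q` is the (monic, probabilists') Hermite
polynomial `H_q(x) = (-1)^q e^{x²/2} (d^q/dx^q) e^{-x²/2}`. -/
def V (q : ℕ) (X : ℤ → Ω → ℝ) (n : ℕ) (ω : Ω) : ℝ :=
  (1 / Real.sqrt n) *
    ∑ k ∈ Finset.range n, Polynomial.aeval (X (k : ℤ) ω) (Polynomial.hermite q)

/-- `v_n = E[V_n²]`. -/
def v (q : ℕ) (P : Measure Ω) (X : ℤ → Ω → ℝ) (n : ℕ) : ℝ :=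
  ∫ ω, (V q X n ω) ^ 2 ∂P

/-- `F_n = V_n / √v_n`. -/
def F (q : ℕ) (P : Measure Ω) (X : ℤ → Ω → ℝ) (n : ℕ) (ω : Ω) : ℝ :=
  V q X n ω / Real.sqrt (v q P X n)

end Sums

instance fact_two_pi_pos : Fact (0 < 2 * Real.pi) := ⟨Real.two_pi_pos⟩

/-- The torus `𝕋 = ℝ / 2πℤ`; its `volume` is Lebesgue measure `dt`, of total mass `2π`, and
`fourier k` on it is `t ↦ exp(i k t)`. -/
abbrev Torus : Type := AddCircle (2 * Real.pi)

/-- The `k`-th term `ρ(k) e^{ikt}` of the Fourier series of `g₁`, as an element of `L²(𝕋)`. -/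
def spectralTerm (ρ : ℤ → ℝ) (k : ℤ) :
    Lp ℂ 2 (AddCircle.haarAddCircle (T := 2 * Real.pi)) :=
  (ρ k : ℂ) • fourierLp (T := 2 * Real.pi) 2 k

/-- `g₁(t) = ∑_{k ∈ ℤ} ρ(k) e^{ikt}`, the sum being taken in `L²(𝕋)`. -/
def g₁ (ρ : ℤ → ℝ) : Lp ℂ 2 (AddCircle.haarAddCircle (T := 2 * Real.pi)) :=
  ∑' k : ℤ, spectralTerm ρ k

end BreuerMajor

end

/-! For a centred variable the fourth cumulant is `E[F⁴] - 3 E[F²]²`. Gaussian integration by parts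
computes the fourth moment of `∑ H_q(X_k)` as a sum over exponents `a + b + c = q` of `diagramCoeff
q a b c` times `quadSum R a b c`, where `R` is the Toeplitz matrix of `ρ`. The three terms in which
one exponent equals `q` are squared variances and cancel against `3 E[F²]²`. What remains is
`connectedSum q R`, so everything reduces to estimating this sum for a positive semidefinite `R`.

Upper bound: every connected term is dominated by `quadSum` of `|R|` with exponents `(q-1, 1, 0)`, a
sum over 4-cycles. AM-GM breaks the cycle into paths, and paths are bounded by row sums
(`quadSum_abs_le`, and `quadSum_abs_one_one_le` for `q = 2`).

Lower bound: positive semidefiniteness makes the connected sum at least one contraction term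
(`le_connectedSum`). By Cauchy-Schwarz on the diagonal of a matrix, that term is at least the
squared variance sum divided by `n` (`sq_sum_pow_le_card_mul_quadSum`). The variance then cancels,
so `n κ₄(F_n)` is bounded below by a constant depending only on `q`.

Limit for `q = 2`: the connected sum is `48 tr(R⁴)`. Dominated convergence over index differences
gives `n⁻¹ tr(R⁴) → ∑ cycleTerm ρ`, and the limit is the squared `ℓ²` norm of `ρ * ρ`. By Parseval
applied to `g₁²` it equals the fourth-power integral of `g₁` for normalised Haar measure. That `g₁`
is real, nonnegative and in `L⁴` is inherited from its Fejér means.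

Positivity of `v_n`: if `v_n = 0`, then `H_q(X_m)` is `n`-periodic in `m` almost surely, which
contradicts `ρ → 0`. -/

/-! ### The fourth cumulant in terms of moments. -/

/-- The fourth derivative at `0` of the logarithm of a function with `φ 0 = 1`, `φ' 0 = 0`. -/
theorem iteratedDeriv_four_log {φ : ℝ → ℂ} (hφ : ContDiff ℝ 4 φ) (h0 : φ 0 = 1)
    (h1 : deriv φ 0 = 0) :
    iteratedDeriv 4 (fun t => Complex.log (φ t)) 0 =
      iteratedDeriv 4 φ 0 - 3 * (iteratedDeriv 2 φ 0) ^ 2 := by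
  set L : ℝ → ℂ := fun t => Complex.log (φ t) with hL
  have hev : ∀ᶠ t in 𝓝 (0 : ℝ), φ t ∈ Complex.slitPlane :=
    hφ.continuous.continuousAt.eventually
      (Complex.isOpen_slitPlane.mem_nhds (by rw [h0]; exact Complex.one_mem_slitPlane))
  have hLc : ContDiffAt ℝ 4 L 0 :=
    ((Complex.contDiffAt_log (by rw [h0]; exact Complex.one_mem_slitPlane)).restrict_scalars ℝ).comp
      (0 : ℝ) hφ.contDiffAt
  have hdφ : Differentiable ℝ φ := hφ.differentiable (by norm_num)
  -- Applying the Leibniz rule to `φ' = L' φ` gives the moment-cumulant recursion and avoids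
  -- differentiating the logarithm four times. The identity holds only near `0`, where `φ` stays in
  -- the slit plane.
  have hev' : deriv φ =ᶠ[𝓝 0] deriv L * φ := by
    filter_upwards [hev] with t ht
    have := ((hdφ t).hasDerivAt.clog_real ht).deriv
    rw [Pi.mul_apply, this, div_mul_cancel₀ _ (Complex.slitPlane_ne_zero ht)]
  have hL' : ContDiffAt ℝ 3 (deriv L) 0 := hLc.derivWithin (by norm_num)
  have key : ∀ k : ℕ, k ≤ 3 → iteratedDeriv (k + 1) φ 0 = ∑ i ∈ Finset.range (k + 1),
      (k.choose i : ℂ) * iteratedDeriv (i + 1) L 0 * iteratedDeriv (k - i) φ 0 := by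
    intro k hk
    have hk' : (k : WithTop ℕ∞) ≤ 3 := by exact_mod_cast hk
    rw [iteratedDeriv_succ', hev'.iteratedDeriv_eq k, iteratedDeriv_mul (hL'.of_le hk')
      (hφ.contDiffAt.of_le (hk'.trans (by norm_num)))]
    simp_rw [iteratedDeriv_succ' (f := L)]
  have k0 := key 0 (by norm_num)
  have k1 := key 1 (by norm_num)
  have k3 := key 3 (by norm_num)
  have hφ1 : iteratedDeriv 1 φ 0 = 0 := by rw [iteratedDeriv_one, h1]
  have c32 : Nat.choose 3 2 = 3 := rfl
  simp only [zero_add, Nat.sub_self, iteratedDeriv_zero, h0, hφ1,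
    Finset.sum_range_succ, Nat.reduceAdd, Nat.reduceSub, Nat.choose_self, Nat.choose_zero_right,
    Nat.choose_one_right, Nat.cast_one, one_mul, mul_one, Finset.range_zero, Finset.sum_empty,
    mul_zero, c32] at k0 k1 k3
  rw [k3, k1, ← k0]
  push_cast
  ring

namespace BreuerMajor
theorem cumulant_four {Ω : Type*} [MeasurableSpace Ω] {P : Measure Ω} [IsProbabilityMeasure P]
    {F : Ω → ℝ} (hF : MemLp F 4 P) (h0 : ∫ ω, F ω ∂P = 0) :
    cumulant P F 4 = ∫ ω, F ω ^ 4 ∂P - 3 * (∫ ω, F ω ^ 2 ∂P) ^ 2 := by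
  have hm : AEMeasurable F P := hF.aestronglyMeasurable.aemeasurable
  have : IsProbabilityMeasure (P.map F) := Measure.isProbabilityMeasure_map hm
  have hid : MemLp id (4 : ℕ) (P.map F) := by
    rw [memLp_map_measure_iff aestronglyMeasurable_id hm]; simpa using hF
  have hmom : ∀ k : ℕ, k ≤ 4 → iteratedDeriv k (charFun (P.map F)) 0 =
      Complex.I ^ k * ((∫ ω, F ω ^ k ∂P : ℝ) : ℂ) := by
    intro k hk
    rw [iteratedDeriv_charFun_zero (hid.mono_exponent (by exact_mod_cast hk))]
    rw [integral_map hm (by fun_prop)]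
  have hlog := iteratedDeriv_four_log (φ := charFun (P.map F))
    (by simpa using contDiff_charFun hid) (by simp)
    (by rw [← iteratedDeriv_one, hmom 1 (by norm_num)]; simp [h0])
  rw [cumulant, hlog, hmom 4 le_rfl, hmom 2 (by norm_num)]
  have : Complex.I ^ 4 = 1 := by simp
  have h' : (-Complex.I) ^ 4 = 1 := by rw [Even.neg_pow (by decide)]; simp
  rw [this, h', Complex.I_sq]
  have : (1 : ℂ) * (1 * ((∫ ω, F ω ^ 4 ∂P : ℝ) : ℂ) - 3 * (-1 * ((∫ ω, F ω ^ 2 ∂P : ℝ) : ℂ)) ^ 2)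
    = ((∫ ω, F ω ^ 4 ∂P - 3 * (∫ ω, F ω ^ 2 ∂P) ^ 2 : ℝ) : ℂ) := by push_cast; ring
  rw [this, Complex.ofReal_re]
end BreuerMajor

/-! ### Hermite polynomials and integration by parts for the standard Gaussian. -/

/-- Random variables all of whose moments are finite. -/
def HasAllMoments {Ω : Type*} [MeasurableSpace Ω] (P : Measure Ω) (f : Ω → ℝ) : Prop :=
  ∀ p : ℕ, MemLp f p P

namespace HasAllMoments

variable {Ω : Type*} [MeasurableSpace Ω] {P : Measure Ω} {f g : Ω → ℝ}

theorem const_mul (hf : HasAllMoments P f) (c : ℝ) :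
    HasAllMoments P (fun ω => c * f ω) := fun p => (hf p).const_mul c

theorem const [IsFiniteMeasure P] (c : ℝ) : HasAllMoments P (fun _ => c) :=
  fun _ => memLp_const c

theorem mul (hf : HasAllMoments P f) (hg : HasAllMoments P g) :
    HasAllMoments P (fun ω => f ω * g ω) := fun p => by
  have : ENNReal.HolderTriple ((2 * p : ℕ) : ℝ≥0∞) ((2 * p : ℕ) : ℝ≥0∞) (p : ℝ≥0∞) := ⟨by
    push_cast
    rw [ENNReal.mul_inv (by simp) (by simp), ← add_mul, ENNReal.inv_two_add_inv_two, one_mul]⟩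
  exact (hg (2 * p)).mul (hf (2 * p))

theorem pow [IsFiniteMeasure P] (hf : HasAllMoments P f) (n : ℕ) :
    HasAllMoments P (fun ω => f ω ^ n) := by
  induction n with
  | zero => simpa using const (P := P) 1
  | succ n ih => simpa only [pow_succ] using ih.mul hf

theorem sum {ι : Type*} (s : Finset ι) {f : ι → Ω → ℝ} (hf : ∀ i ∈ s, HasAllMoments P (f i)) :
    HasAllMoments P (fun ω => ∑ i ∈ s, f i ω) := fun p => memLp_finsetSum s fun i hi => hf i hi p

theorem polynomial_eval [IsFiniteMeasure P] (hf : HasAllMoments P f) (g : Polynomial ℝ) :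
    HasAllMoments P (fun ω => g.eval (f ω)) := by
  simp only [Polynomial.eval_eq_sum_range]
  exact sum _ fun i _ => (hf.pow i).const_mul _

theorem integrable (hf : HasAllMoments P f) : Integrable f P :=
  memLp_one_iff_integrable.1 (by simpa using hf 1)

end HasAllMoments

open Polynomial in
/-- Gaussian integration by parts for polynomials. -/
theorem integral_mul_eval_gaussianReal (g : ℝ[X]) :
    ∫ x, x * g.eval x ∂(gaussianReal 0 1) = ∫ x, (derivative g).eval x ∂(gaussianReal 0 1) := by
  have hid : HasAllMoments (gaussianReal 0 1) (fun x => x) := fun p =>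
    memLp_id_gaussianReal' p (by simp)
  have hI : ∀ h : ℝ[X], Integrable (fun x => gaussianPDFReal 0 1 x * h.eval x) := by
    intro h
    have := (hid.polynomial_eval h).integrable
    rw [gaussianReal_of_var_ne_zero _ one_ne_zero, integrable_withDensity_iff_integrable_smul'
      (measurable_gaussianPDF _ _) (by simp [gaussianPDF])] at this
    simpa using this
  have hd : ∀ x, HasDerivAt (gaussianPDFReal 0 1) (-x * gaussianPDFReal 0 1 x) x := by
    intro x
    simp only [gaussianPDFReal_def]
    have h1 : HasDerivAt (fun x : ℝ => -(x - 0) ^ 2 / (2 * ((1 : NNReal) : ℝ))) (-x) x := by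
      have := (((hasDerivAt_id x).sub_const 0).pow 2).neg.div_const (2 * ((1 : NNReal) : ℝ))
      convert! this using 1
      simp
      ring
    convert! (h1.exp).const_mul _ using 1
    ring
  -- The integrand is the derivative of density times `g`. Both functions are integrable, so no
  -- boundary term appears.
  have hz : ∫ x, (gaussianPDFReal 0 1 x * (derivative g).eval x
      - gaussianPDFReal 0 1 x * (X * g).eval x) = 0 := by
    refine integral_eq_zero_of_hasDerivAt_of_integrable
      (f := fun x => gaussianPDFReal 0 1 x * g.eval x) (fun x => ?_) ((hI _).sub (hI _)) (hI _)
    convert! (hd x).mul (g.hasDerivAt x) using 1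
    simp; ring
  rw [integral_sub (hI _) (hI _)] at hz
  rw [integral_gaussianReal_eq_integral_smul one_ne_zero,
    integral_gaussianReal_eq_integral_smul one_ne_zero]
  simp only [smul_eq_mul]
  simp only [eval_mul, eval_X] at hz
  linarith

namespace Polynomial

/-- The probabilists' Hermite polynomial with real coefficients. -/
noncomputable def realHermite (n : ℕ) : ℝ[X] := (hermite n).map (Int.castRingHom ℝ)

theorem eval_realHermite (n : ℕ) (x : ℝ) : (realHermite n).eval x = aeval x (hermite n) := by
  rw [realHermite, eval_map]; rfl

theorem realHermite_zero : realHermite 0 = 1 := by simp [realHermite]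

theorem realHermite_succ (n : ℕ) :
    realHermite (n + 1) = X * realHermite n - derivative (realHermite n) := by
  simp [realHermite, hermite_succ, derivative_map]

theorem derivative_realHermite_succ (n : ℕ) :
    derivative (realHermite (n + 1)) = (n + 1 : ℝ[X]) * realHermite n := by
  induction n with
  | zero => simp [realHermite]
  | succ n ih =>
    rw [realHermite_succ (n + 1), derivative_sub, derivative_mul, ih, derivative_X, one_mul,
      derivative_mul]
    have : derivative (n + 1 : ℝ[X]) = 0 := by
      rw [derivative_add, derivative_natCast, derivative_one, add_zero]
    rw [this, zero_mul, zero_add]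
    conv_rhs => rw [add_mul, one_mul]
    conv_lhs => rw [realHermite_succ n]
    rw [realHermite_succ n]
    push_cast
    ring

theorem iterate_derivative_realHermite (k n : ℕ) :
    derivative^[k] (realHermite n) = C (n.descFactorial k : ℝ) * realHermite (n - k) := by
  induction k with
  | zero => simp
  | succ k ih =>
    rw [Function.iterate_succ_apply', ih, derivative_C_mul, Nat.descFactorial_succ]
    rcases Nat.lt_or_ge k n with h | h
    · obtain ⟨m, rfl⟩ : ∃ m, n = k + (m + 1) := ⟨n - k - 1, by omega⟩
      rw [show k + (m + 1) - k = m + 1 by omega, show k + (m + 1) - (k + 1) = m by omega,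
        derivative_realHermite_succ]
      push_cast
      simp only [map_mul, map_add, map_natCast, map_one]
      ring
    · rw [show n - k = 0 by omega]
      simp [realHermite_zero]

theorem iterate_derivative_comp_linear (g : ℝ[X]) (r z : ℝ) (k : ℕ) :
    derivative^[k] (g.comp (C r * X + C z)) =
      C (r ^ k) * (derivative^[k] g).comp (C r * X + C z) := by
  induction k generalizing g with
  | zero => simp
  | succ k ih =>
    rw [Function.iterate_succ_apply', ih, derivative_C_mul, derivative_comp,
      Function.iterate_succ_apply']
    simp only [derivative_add, derivative_C_mul, derivative_X, derivative_C, pow_succ, map_mul]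
    ring

end Polynomial

-- Multiplication by `x` minus differentiation is the adjoint of differentiation under the Gaussian
-- measure, and it raises `H_p` to `H_{p+1}`. Hence each degree of the Hermite factor costs one
-- derivative of `g`.
open Polynomial in
theorem integral_realHermite_mul_gaussianReal (p : ℕ) (g : ℝ[X]) :
    ∫ x, (realHermite p).eval x * g.eval x ∂(gaussianReal 0 1) =
      ∫ x, (derivative^[p] g).eval x ∂(gaussianReal 0 1) := by
  have hid : HasAllMoments (gaussianReal 0 1) (fun x => x) := fun p =>
    memLp_id_gaussianReal' p (by simp)
  induction p generalizing g with
  | zero => simp [realHermite_zero]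
  | succ p ih =>
    rw [Function.iterate_succ_apply, ← ih, realHermite_succ]
    have h := integral_mul_eval_gaussianReal (realHermite p * g)
    have h1 : ∀ x, (X * realHermite p - derivative (realHermite p)).eval x * g.eval x =
      x * (realHermite p * g).eval x - (derivative (realHermite p) * g).eval x := by
      intro x; simp; ring
    have hi : Integrable (fun x : ℝ => x * (realHermite p * g).eval x) (gaussianReal 0 1) :=
      (hid.mul (hid.polynomial_eval _)).integrable
    simp_rw [h1]
    rw [integral_sub hi (hid.polynomial_eval _).integrable, h,
      ← integral_sub (hid.polynomial_eval _).integrable (hid.polynomial_eval _).integrable]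
    congr 1; ext x
    simp

/-! ### Contraction of one Hermite factor in a Gaussian family. -/

/-- A process whose values are continuous linear functions of finitely many values of a Gaussian
process is Gaussian. -/
theorem ProbabilityTheory.IsGaussianProcess.of_forall_exists_clm {S T Ω : Type*}
    [MeasurableSpace Ω] {P : Measure Ω} {X : T → Ω → ℝ} {Y : S → Ω → ℝ}
    (hX : IsGaussianProcess X P)
    (h : ∀ s, ∃ I : Finset T, ∃ L : (I → ℝ) →L[ℝ] ℝ, ∀ ω, Y s ω = L (I.restrict (X · ω))) :
    IsGaussianProcess Y P where
  hasGaussianLaw I := by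
    classical
    choose J L hL using h
    let K : (I.biUnion J → ℝ) →L[ℝ] I → ℝ := ContinuousLinearMap.pi fun s => (L s).comp
      (ContinuousLinearMap.pi fun t =>
        ContinuousLinearMap.proj ⟨t.1, Finset.mem_biUnion.2 ⟨s.1, s.2, t.2⟩⟩)
    have : (fun ω => I.restrict (Y · ω)) = K ∘ (fun ω => (I.biUnion J).restrict (X · ω)) := by
      ext ω s
      simp only [Finset.restrict_def, hL, Function.comp_apply, K]
      rfl
    rw [this]
    exact (hX.hasGaussianLaw _).map _

open Polynomial in
/-- The Leibniz rule for a product of three polynomials. -/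
theorem Polynomial.iterate_derivative_mul_three (p : ℕ) (f g h : ℝ[X]) :
    derivative^[p] (f * (g * h)) =
      ∑ x ∈ Finset.HasAntidiagonal.antidiagonal p, ∑ y ∈ Finset.HasAntidiagonal.antidiagonal x.2,
      C ((p.choose x.1 : ℝ) * (x.2.choose y.1 : ℝ)) *
        (derivative^[x.1] f * (derivative^[y.1] g * derivative^[y.2] h)) := by
  have key : ∀ (p : ℕ) (f g : ℝ[X]), derivative^[p] (f * g) =
      ∑ x ∈ Finset.HasAntidiagonal.antidiagonal p,
      C (p.choose x.1 : ℝ) * (derivative^[x.1] f * derivative^[x.2] g) := by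
    intro p f g
    rw [mul_comm f g, iterate_derivative_mul, Finset.Nat.sum_antidiagonal_eq_sum_range_succ
      (fun i j => C (p.choose i : ℝ) * (derivative^[i] f * derivative^[j] g))]
    refine Finset.sum_congr rfl fun k _ => ?_
    rw [nsmul_eq_mul, map_natCast]
    ring
  rw [key]
  refine Finset.sum_congr rfl fun x _ => ?_
  rw [key, Finset.mul_sum, Finset.mul_sum]
  refine Finset.sum_congr rfl fun y _ => ?_
  rw [map_mul]
  ring

section Wick

variable {Ω T : Type*} [MeasurableSpace Ω] {P : Measure Ω} {Y : T → Ω → ℝ} {r : T → T → ℝ}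

/-- A centered Gaussian process with unit variances and covariance `r`. -/
structure IsUnitGaussianFamily (P : Measure Ω) (Y : T → Ω → ℝ) (r : T → T → ℝ) : Prop where
  gaussian : IsGaussianProcess Y P
  centered : ∀ t, ∫ ω, Y t ω ∂P = 0
  cov_eq : ∀ s t, ∫ ω, Y s ω * Y t ω ∂P = r s t
  unit : ∀ t, r t t = 1

namespace IsUnitGaussianFamily

theorem hasAllMoments (h : IsUnitGaussianFamily P Y r) (t : T) : HasAllMoments P (Y t) :=
  fun p => (h.gaussian.hasGaussianLaw_eval t).memLp (by simp)

theorem symm (h : IsUnitGaussianFamily P Y r) (s t : T) : r s t = r t s := by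
  rw [← h.cov_eq, ← h.cov_eq]; simp_rw [mul_comm]

theorem map_eq [IsProbabilityMeasure P] (h : IsUnitGaussianFamily P Y r) (t : T) :
    P.map (Y t) = gaussianReal 0 1 := by
  rw [(h.gaussian.hasGaussianLaw_eval t).map_eq_gaussianReal, h.centered,
    variance_of_integral_eq_zero (h.gaussian.aemeasurable t) (h.centered t)]
  have : ∫ ω, Y t ω ^ 2 ∂P = 1 := by simp_rw [pow_two, h.cov_eq, h.unit]
  rw [this, Real.toNNReal_one]

/-- The residuals `Y t - r s t Y s` are independent of `Y s`. -/
theorem indepFun_residual [IsProbabilityMeasure P] (h : IsUnitGaussianFamily P Y r) (s : T) :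
    IndepFun (Y s) (fun ω t => Y t ω - r s t * Y s ω) P := by
  classical
  have hG : IsGaussianProcess
      (Sum.elim (fun _ : Unit => Y s) (fun t ω => Y t ω - r s t * Y s ω)) P := by
    refine h.gaussian.of_forall_exists_clm fun i => ?_
    rcases i with i | t
    · exact ⟨{s}, ContinuousLinearMap.proj (⟨s, by simp⟩ : ({s} : Finset T)), fun ω => by simp⟩
    · exact ⟨{s, t}, ContinuousLinearMap.proj (⟨t, by simp⟩ : ({s, t} : Finset T)) -
        r s t • ContinuousLinearMap.proj (⟨s, by simp⟩ : ({s, t} : Finset T)), fun ω => by simp⟩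
  have hm := h.gaussian.aemeasurable
  have hI := hG.indepFun_of_covariance_eq_zero (fun _ => hm s)
    (fun t => (hm t).sub ((hm s).const_mul _)) (fun _ t => ?_)
  · exact hI.comp (φ := fun x : Unit → ℝ => x ()) (ψ := id) (by fun_prop) measurable_id
  · have h2 : ∀ t, MemLp (Y t) 2 P := fun t => by simpa using h.hasAllMoments t 2
    have hs := h.hasAllMoments
    have e : ∀ ω, Y s ω * (Y t ω - r s t * Y s ω) = Y s ω * Y t ω - r s t * (Y s ω * Y s ω) :=
      fun ω => by ring
    have hZ : MemLp (fun ω => Y t ω - r s t * Y s ω) 2 P := (h2 t).sub ((h2 s).const_mul _)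
    rw [covariance_eq_sub (h2 s) hZ, h.centered s]
    simp only [Pi.mul_apply, e]
    rw [integral_sub ((hs s).mul (hs t)).integrable (((hs s).mul (hs s)).const_mul _).integrable,
      integral_const_mul, h.cov_eq, h.cov_eq, h.unit]
    simp

open Polynomial in
/-- Integration by parts: all factors of a Hermite polynomial are contracted with the others. -/
theorem integral_realHermite_mul [IsProbabilityMeasure P] (h : IsUnitGaussianFamily P Y r)
    (p : ℕ) (s t₁ t₂ t₃ : T) (g₁ g₂ g₃ : ℝ[X]) :
    ∫ ω, (realHermite p).eval (Y s ω) *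
        (g₁.eval (Y t₁ ω) * (g₂.eval (Y t₂ ω) * g₃.eval (Y t₃ ω))) ∂P =
      ∑ x ∈ Finset.HasAntidiagonal.antidiagonal p, ∑ y ∈ Finset.HasAntidiagonal.antidiagonal x.2,
        ((p.choose x.1 : ℝ) * (x.2.choose y.1 : ℝ)) *
          (r s t₁ ^ x.1 * (r s t₂ ^ y.1 * r s t₃ ^ y.2)) *
        ∫ ω, (derivative^[x.1] g₁).eval (Y t₁ ω) *
          ((derivative^[y.1] g₂).eval (Y t₂ ω) * (derivative^[y.2] g₃).eval (Y t₃ ω)) ∂P := by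
  have hs := h.hasAllMoments
  have hm := h.gaussian.aemeasurable
  -- With `Y t = r s t * Y s + Z t` and `Z` independent of `Y s`, freezing `Z` turns the other
  -- factors into polynomials in one standard Gaussian. The one-variable formula applies, and each
  -- derivative falling on the factor at `tᵢ` brings out one `r s tᵢ`.
  set Z : Ω → ℝ × ℝ × ℝ := fun ω =>
    (Y t₁ ω - r s t₁ * Y s ω, Y t₂ ω - r s t₂ * Y s ω, Y t₃ ω - r s t₃ * Y s ω) with hZ
  have hind : IndepFun (Y s) Z P := (h.indepFun_residual s).comp (φ := id)
    (ψ := fun z : T → ℝ => (z t₁, z t₂, z t₃)) measurable_id (by fun_prop)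
  have hZm : AEMeasurable Z P := by fun_prop
  have hlaw : P.map (fun ω => (Y s ω, Z ω)) = (gaussianReal 0 1).prod (P.map Z) := by
    rw [(indepFun_iff_map_prod_eq_prod_map_map (hm s) hZm).1 hind, h.map_eq]
  have : IsProbabilityMeasure (P.map Z) := Measure.isProbabilityMeasure_map hZm
  have hfub : ∀ Φ : ℝ × ℝ × ℝ × ℝ → ℝ, Continuous Φ → Integrable (fun ω => Φ (Y s ω, Z ω)) P →
      ∫ ω, Φ (Y s ω, Z ω) ∂P = ∫ z, ∫ x, Φ (x, z) ∂(gaussianReal 0 1) ∂(P.map Z) := by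
    intro Φ hΦ hint
    rw [← integral_map (φ := fun ω => (Y s ω, Z ω)) (f := Φ) ((hm s).prodMk hZm)
      hΦ.aestronglyMeasurable, hlaw, integral_prod_symm]
    rw [← hlaw, integrable_map_measure hΦ.aestronglyMeasurable ((hm s).prodMk hZm)]
    exact hint
  let Φ : ℝ × ℝ × ℝ × ℝ → ℝ := fun x => (realHermite p).eval x.1 *
    (g₁.eval (r s t₁ * x.1 + x.2.1) * (g₂.eval (r s t₂ * x.1 + x.2.2.1) *
      g₃.eval (r s t₃ * x.1 + x.2.2.2)))
  let Ψ : ℝ × ℝ × ℝ × ℝ → ℝ := fun w => ∑ x ∈ Finset.HasAntidiagonal.antidiagonal p,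
    ∑ y ∈ Finset.HasAntidiagonal.antidiagonal x.2, ((p.choose x.1 : ℝ) * (x.2.choose y.1 : ℝ)) *
      (r s t₁ ^ x.1 * (r s t₂ ^ y.1 * r s t₃ ^ y.2)) *
      ((derivative^[x.1] g₁).eval (r s t₁ * w.1 + w.2.1) *
        ((derivative^[y.1] g₂).eval (r s t₂ * w.1 + w.2.2.1) *
          (derivative^[y.2] g₃).eval (r s t₃ * w.1 + w.2.2.2)))
  have hΦc : Continuous Φ := by fun_prop
  have hΨc : Continuous Ψ := by fun_prop
  have hΦe : ∀ ω, Φ (Y s ω, Z ω) = (realHermite p).eval (Y s ω) *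
        (g₁.eval (Y t₁ ω) * (g₂.eval (Y t₂ ω) * g₃.eval (Y t₃ ω))) := by
    intro ω; simp [Φ, hZ]
  have hΨe : ∀ ω, Ψ (Y s ω, Z ω) =
      ∑ x ∈ Finset.HasAntidiagonal.antidiagonal p, ∑ y ∈ Finset.HasAntidiagonal.antidiagonal x.2,
        ((p.choose x.1 : ℝ) * (x.2.choose y.1 : ℝ)) *
          (r s t₁ ^ x.1 * (r s t₂ ^ y.1 * r s t₃ ^ y.2)) *
        ((derivative^[x.1] g₁).eval (Y t₁ ω) *
          ((derivative^[y.1] g₂).eval (Y t₂ ω) * (derivative^[y.2] g₃).eval (Y t₃ ω))) := by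
    intro ω; simp [Ψ, hZ]
  have hterm : ∀ a b c : ℝ[X], HasAllMoments P
      (fun ω => a.eval (Y t₁ ω) * (b.eval (Y t₂ ω) * c.eval (Y t₃ ω))) := fun a b c =>
    ((hs t₁).polynomial_eval a).mul (((hs t₂).polynomial_eval b).mul ((hs t₃).polynomial_eval c))
  have hΦi : HasAllMoments P (fun ω => Φ (Y s ω, Z ω)) := by
    simp only [hΦe]
    exact ((hs s).polynomial_eval _).mul (hterm _ _ _)
  have hΨi : HasAllMoments P (fun ω => Ψ (Y s ω, Z ω)) := by
    simp only [hΨe]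
    exact .sum _ fun x _ => .sum _ fun y _ => (hterm _ _ _).const_mul _
  have hpt : ∀ z, ∫ x, Φ (x, z) ∂(gaussianReal 0 1) = ∫ x, Ψ (x, z) ∂(gaussianReal 0 1) := by
    rintro ⟨z₁, z₂, z₃⟩
    have := integral_realHermite_mul_gaussianReal p (g₁.comp (C (r s t₁) * X + C z₁) *
      (g₂.comp (C (r s t₂) * X + C z₂) * g₃.comp (C (r s t₃) * X + C z₃)))
    rw [iterate_derivative_mul_three] at this
    simp only [iterate_derivative_comp_linear, eval_finsetSum, eval_mul, eval_C, eval_comp,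
      eval_add, eval_X] at this
    simp only [Φ, Ψ]
    rw [this]
    congr 1; ext x
    refine Finset.sum_congr rfl fun _ _ => Finset.sum_congr rfl fun _ _ => ?_
    ring
  have main := hfub Φ hΦc hΦi.integrable
  simp_rw [hpt] at main
  rw [← hfub Ψ hΨc hΨi.integrable] at main
  simp_rw [hΦe, hΨe] at main
  rw [main, integral_finsetSum _ fun x _ => (HasAllMoments.sum _ fun y _ =>
    (hterm _ _ _).const_mul _).integrable]
  refine Finset.sum_congr rfl fun x _ => ?_
  rw [integral_finsetSum _ fun y _ => ((hterm _ _ _).const_mul _).integrable]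
  exact Finset.sum_congr rfl fun y _ => integral_const_mul _ _

end IsUnitGaussianFamily

end Wick

/-! ### The diagram formula for two, three and four Hermite factors. -/

section

theorem Nat.cast_descFactorial_add (k m : ℕ) :
    ((k + m).descFactorial k : ℝ) = (k + m).factorial / m.factorial := by
  rw [eq_div_iff (by positivity)]
  have := Nat.factorial_mul_descFactorial (Nat.le_add_right k m)
  rw [Nat.add_sub_cancel_left] at this
  rw [mul_comm]; exact_mod_cast this

theorem Nat.cast_choose_add (k m : ℕ) :
    ((k + m).choose k : ℝ) = (k + m).factorial / (k.factorial * m.factorial) :=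
  Nat.cast_add_choose ℝ

/-- The coefficient `q!⁴ / (a! b! c!)²` in the diagram formula. -/
noncomputable def diagramCoeff (q a b c : ℕ) : ℝ :=
  (q.factorial : ℝ) ^ 4 / ((a.factorial : ℝ) * b.factorial * c.factorial) ^ 2

open Polynomial Finset.HasAntidiagonal

namespace IsUnitGaussianFamily

variable {Ω T : Type*} [MeasurableSpace Ω] {P : Measure Ω} [IsProbabilityMeasure P]
  {Y : T → Ω → ℝ} {r : T → T → ℝ}

theorem integral_realHermite (h : IsUnitGaussianFamily P Y r) (k : ℕ) (t : T) :
    ∫ ω, (realHermite k).eval (Y t ω) ∂P = if k = 0 then 1 else 0 := by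
  have := integral_realHermite_mul_gaussianReal k 1
  simp only [eval_one, mul_one] at this
  rw [← integral_map (φ := Y t) (f := fun x => (realHermite k).eval x) (h.gaussian.aemeasurable t)
    (by fun_prop), h.map_eq, this, ← realHermite_zero, iterate_derivative_realHermite]
  rcases k with _ | k <;> simp [realHermite_zero]

theorem integral_realHermite_four_step (h : IsUnitGaussianFamily P Y r)
    (p a b c : ℕ) (s t₁ t₂ t₃ : T) :
    ∫ ω, (realHermite p).eval (Y s ω) * ((realHermite a).eval (Y t₁ ω) *
        ((realHermite b).eval (Y t₂ ω) * (realHermite c).eval (Y t₃ ω))) ∂P =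
      ∑ x ∈ antidiagonal p, ∑ y ∈ antidiagonal x.2,
        ((p.choose x.1 : ℝ) * (x.2.choose y.1 : ℝ)) *
          (r s t₁ ^ x.1 * (r s t₂ ^ y.1 * r s t₃ ^ y.2)) *
        ((a.descFactorial x.1 : ℝ) * (b.descFactorial y.1 : ℝ) * (c.descFactorial y.2 : ℝ)) *
        ∫ ω, (realHermite (a - x.1)).eval (Y t₁ ω) * ((realHermite (b - y.1)).eval (Y t₂ ω) *
          (realHermite (c - y.2)).eval (Y t₃ ω)) ∂P := by
  rw [h.integral_realHermite_mul]
  refine Finset.sum_congr rfl fun x _ => Finset.sum_congr rfl fun y _ => ?_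
  simp only [iterate_derivative_realHermite, eval_mul, eval_C]
  have key : ∀ (d e f : ℝ) (u v w : Ω → ℝ),
      ∫ ω, d * u ω * (e * v ω * (f * w ω)) ∂P = d * e * f * ∫ ω, u ω * (v ω * w ω) ∂P := by
    intro d e f u v w
    rw [← integral_const_mul]
    congr 1; ext ω; ring
  rw [key, mul_assoc _ (_ * _ * _)]

theorem integral_realHermite_three_step (h : IsUnitGaussianFamily P Y r)
    (p a b : ℕ) (s t₁ t₂ : T) :
    ∫ ω, (realHermite p).eval (Y s ω) * ((realHermite a).eval (Y t₁ ω) *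
        (realHermite b).eval (Y t₂ ω)) ∂P =
      ∑ x ∈ antidiagonal p, (p.choose x.1 : ℝ) * (r s t₁ ^ x.1 * r s t₂ ^ x.2) *
        ((a.descFactorial x.1 : ℝ) * (b.descFactorial x.2 : ℝ)) *
        ∫ ω, (realHermite (a - x.1)).eval (Y t₁ ω) * (realHermite (b - x.2)).eval (Y t₂ ω) ∂P := by
  -- The fourth factor is `H_0 = 1`. Any contraction with it carries a vanishing `descFactorial`.
  have := h.integral_realHermite_four_step p a b 0 s t₁ t₂ t₂
  simp only [realHermite_zero, eval_one, mul_one, zero_le, Nat.sub_eq_zero_of_le] at this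
  rw [this]
  refine Finset.sum_congr rfl fun x _ => ?_
  rw [Finset.sum_eq_single (x.2, 0)]
  · simp
  · rintro ⟨y₁, y₂⟩ hy hne
    rw [mem_antidiagonal] at hy
    have : y₂ ≠ 0 := by rintro rfl; apply hne; simp at hy; simp [hy]
    obtain ⟨z, rfl⟩ := Nat.exists_eq_succ_of_ne_zero this
    simp
  · intro hx; simp at hx

/-- Hermite polynomials of jointly Gaussian variables are orthogonal. -/
theorem integral_realHermite_two (h : IsUnitGaussianFamily P Y r) (p a : ℕ) (s t : T) :
    ∫ ω, (realHermite p).eval (Y s ω) * (realHermite a).eval (Y t ω) ∂P =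
      if p = a then p.factorial * r s t ^ p else 0 := by
  have := h.integral_realHermite_three_step p a 0 s t t
  simp only [realHermite_zero, eval_one, mul_one, zero_le, Nat.sub_eq_zero_of_le] at this
  rw [this, Finset.sum_eq_single (p, 0)]
  · rw [h.integral_realHermite]
    rcases lt_trichotomy p a with h1 | rfl | h1
    · simp [h1.ne, show a - p ≠ 0 by omega]
    · simp [Nat.descFactorial_self, mul_comm]
    · simp [h1.ne', Nat.descFactorial_of_lt h1]
  · rintro ⟨y₁, y₂⟩ hy hne
    rw [mem_antidiagonal] at hy
    have : y₂ ≠ 0 := by rintro rfl; apply hne; simp at hy; simp [hy]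
    obtain ⟨z, rfl⟩ := Nat.exists_eq_succ_of_ne_zero this
    simp
  · intro hx; simp at hx

/-- The degrees are parametrised by the edge counts of the only possible diagram: `c` edges between
`s` and `t₁`, `b` between `s` and `t₂`, `a` between `t₁` and `t₂`. Any other contraction of the
first factor leaves two Hermite polynomials of different degrees, or exceeds an available degree. -/
theorem integral_realHermite_three (h : IsUnitGaussianFamily P Y r) (a b c : ℕ) (s t₁ t₂ : T) :
    ∫ ω, (realHermite (b + c)).eval (Y s ω) * ((realHermite (a + c)).eval (Y t₁ ω) *
        (realHermite (a + b)).eval (Y t₂ ω)) ∂P =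
      ((b + c).factorial : ℝ) * (a + c).factorial * (a + b).factorial /
        ((a.factorial : ℝ) * b.factorial * c.factorial) *
        (r s t₁ ^ c * r s t₂ ^ b * r t₁ t₂ ^ a) := by
  rw [h.integral_realHermite_three_step, Finset.sum_eq_single (c, b)]
  · rw [Nat.add_sub_cancel, Nat.add_sub_cancel, h.integral_realHermite_two, if_pos rfl]
    rw [add_comm b c, add_comm a c, add_comm a b, Nat.cast_choose_add, Nat.cast_descFactorial_add,
      Nat.cast_descFactorial_add]
    field_simp
  · rintro ⟨y₁, y₂⟩ hy hne
    rw [mem_antidiagonal] at hy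
    simp only at hy ⊢
    rw [h.integral_realHermite_two]
    rcases Nat.lt_or_ge (a + c) y₁ with h1 | h1
    · simp [Nat.descFactorial_of_lt h1]
    rcases Nat.lt_or_ge (a + b) y₂ with h2 | h2
    · simp [Nat.descFactorial_of_lt h2]
    rw [if_neg, mul_zero]
    intro h3
    exact hne (by rw [Prod.mk.injEq]; omega)
  · intro hx; simp [add_comm] at hx

/-- The diagram formula for four Hermite polynomials of the same degree. -/
theorem integral_realHermite_four (h : IsUnitGaussianFamily P Y r) (q : ℕ) (s t₁ t₂ t₃ : T) :
    ∫ ω, (realHermite q).eval (Y s ω) * ((realHermite q).eval (Y t₁ ω) *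
        ((realHermite q).eval (Y t₂ ω) * (realHermite q).eval (Y t₃ ω))) ∂P =
      ∑ x ∈ antidiagonal q, ∑ y ∈ antidiagonal x.2, diagramCoeff q x.1 y.1 y.2 *
        ((r s t₁ * r t₂ t₃) ^ x.1 * (r s t₂ * r t₁ t₃) ^ y.1 * (r s t₃ * r t₁ t₂) ^ y.2) := by
  rw [h.integral_realHermite_four_step]
  refine Finset.sum_congr rfl ?_
  rintro ⟨a, m⟩ hx
  refine Finset.sum_congr rfl ?_
  rintro ⟨b, c⟩ hy
  rw [mem_antidiagonal] at hx hy
  simp only at hx hy ⊢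
  subst hy
  subst hx
  -- Once the first vertex has spent `a`, `b`, `c` edges, the residual degrees `b + c`, `a + c`, `a
  -- + b` force the last three edge multiplicities. Opposite edges therefore carry equal exponents.
  rw [show a + (b + c) - a = b + c by omega, show a + (b + c) - b = a + c by omega,
    show a + (b + c) - c = a + b by omega, h.integral_realHermite_three]
  rw [Nat.cast_choose_add, Nat.cast_choose_add, Nat.cast_descFactorial_add]
  have e2 := Nat.cast_descFactorial_add b (a + c)
  have e3 := Nat.cast_descFactorial_add c (a + b)
  rw [show b + (a + c) = a + (b + c) by omega] at e2
  rw [show c + (a + b) = a + (b + c) by omega] at e3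
  rw [e2, e3, diagramCoeff]
  simp only [mul_pow]
  field_simp

end IsUnitGaussianFamily

end

/-! ### Separating connected diagrams from pairings. -/

section

open Polynomial Finset.HasAntidiagonal

/-- The sum `∑ (R_ij R_kl)^a (R_ik R_jl)^b (R_il R_jk)^c` over all quadruples of indices. -/
def quadSum {ι : Type*} [Fintype ι] (R : ι → ι → ℝ) (a b c : ℕ) : ℝ :=
  ∑ i, ∑ j, ∑ k, ∑ l, (R i j * R k l) ^ a * (R i k * R j l) ^ b * (R i l * R j k) ^ c

/-- The fourth cumulant of `∑ H_q(Y_i)` for a Gaussian vector `Y` with correlation matrix `R`: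
the part of the diagram formula over the connected diagrams. -/
noncomputable def connectedSum {ι : Type*} [Fintype ι] (q : ℕ) (R : ι → ι → ℝ) : ℝ :=
  ∑ x ∈ antidiagonal q, ∑ y ∈ antidiagonal x.2,
    if x.1 = q ∨ y.1 = q ∨ y.2 = q then 0 else
      diagramCoeff q x.1 y.1 y.2 * quadSum R x.1 y.1 y.2

section

variable {ι : Type*} [Fintype ι] (R : ι → ι → ℝ)

theorem quadSum_left (q : ℕ) : quadSum R q 0 0 = (∑ i, ∑ j, R i j ^ q) ^ 2 := by
  simp only [quadSum, pow_zero, mul_one, mul_pow, pow_two, Finset.sum_mul,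
    Finset.mul_sum]
  simp only [mul_comm]

theorem quadSum_middle (q : ℕ) : quadSum R 0 q 0 = (∑ i, ∑ j, R i j ^ q) ^ 2 := by
  rw [← quadSum_left]
  simp only [quadSum, pow_zero, mul_one, one_mul]
  exact Finset.sum_congr rfl fun i _ => Finset.sum_comm

theorem quadSum_right (q : ℕ) : quadSum R 0 0 q = (∑ i, ∑ j, R i j ^ q) ^ 2 := by
  rw [← quadSum_left]
  simp only [quadSum, pow_zero, mul_one, one_mul]
  refine Finset.sum_congr rfl fun i _ => ?_
  rw [show ∑ j, ∑ k, ∑ l, (R i l * R j k) ^ q = ∑ j, ∑ l, ∑ k, (R i l * R j k) ^ q from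
    Finset.sum_congr rfl fun j _ => Finset.sum_comm, Finset.sum_comm]

/-- An exponent equal to `q` means that the four vertices are matched in two pairs. There are three
such matchings. Each has coefficient `q!²` and factors into the square of the double sum, so
together they are exactly what the cumulant subtracts. -/
theorem sum_diagrams_eq {q : ℕ} (hq : 1 ≤ q) :
    ∑ x ∈ antidiagonal q, ∑ y ∈ antidiagonal x.2,
      diagramCoeff q x.1 y.1 y.2 * quadSum R x.1 y.1 y.2 =
    connectedSum q R + 3 * (q.factorial * ∑ i, ∑ j, R i j ^ q) ^ 2 := by
  set f : ℕ × ℕ → ℕ × ℕ → ℝ := fun x y => diagramCoeff q x.1 y.1 y.2 * quadSum R x.1 y.1 y.2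
  have hsplit : ∀ x ∈ antidiagonal q, ∀ y ∈ antidiagonal x.2, f x y =
      (if x.1 = q ∨ y.1 = q ∨ y.2 = q then 0 else f x y) +
        (if x = (q, 0) ∧ y = (0, 0) then f x y else 0)
      + (if x = (0, q) ∧ y = (q, 0) then f x y else 0)
      + (if x = (0, q) ∧ y = (0, q) then f x y else 0) := by
    rintro ⟨a, m⟩ hx ⟨b, c⟩ hy
    rw [mem_antidiagonal] at hx hy
    simp only [Prod.mk.injEq] at hx hy ⊢
    by_cases h1 : a = q
    · rw [if_pos (by omega), if_pos (by omega), if_neg (by omega), if_neg (by omega)]; ring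
    by_cases h2 : b = q
    · rw [if_pos (by omega), if_neg (by omega), if_pos (by omega), if_neg (by omega)]; ring
    by_cases h3 : c = q
    · rw [if_pos (by omega), if_neg (by omega), if_neg (by omega), if_pos (by omega)]; ring
    rw [if_neg (by omega), if_neg (by omega), if_neg (by omega), if_neg (by omega)]; ring
  have hsingle : ∀ x₀ y₀ : ℕ × ℕ, x₀ ∈ antidiagonal q → y₀ ∈ antidiagonal x₀.2 →
      ∑ x ∈ antidiagonal q, ∑ y ∈ antidiagonal x.2, (if x = x₀ ∧ y = y₀ then f x y else 0) =
        f x₀ y₀ := by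
    intro x₀ y₀ h1 h2
    rw [Finset.sum_eq_single x₀ ?_ (fun h => absurd h1 h)]
    · rw [Finset.sum_eq_single y₀ ?_ (fun h => absurd h2 h)]
      · simp
      · intro y _ hy; simp [hy]
    · intro x _ hx; simp [hx]
  rw [Finset.sum_congr rfl fun x hx => Finset.sum_congr rfl fun y hy => hsplit x hx y hy]
  simp only [Finset.sum_add_distrib]
  rw [hsingle _ _ (by simp) (by simp), hsingle _ _ (by simp) (by simp),
    hsingle _ _ (by simp) (by simp)]
  have hf : (q.factorial : ℝ) ≠ 0 := by positivity
  simp only [f, diagramCoeff, quadSum_left, quadSum_middle, quadSum_right, connectedSum,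
    Nat.factorial_zero, Nat.cast_one, mul_one, one_mul]
  field_simp
  ring

end

namespace IsUnitGaussianFamily

variable {Ω T ι : Type*} [MeasurableSpace Ω] {P : Measure Ω} [IsProbabilityMeasure P] [Fintype ι]
  {Y : T → Ω → ℝ} {r : T → T → ℝ}

theorem hasAllMoments_sum (h : IsUnitGaussianFamily P Y r) (q : ℕ) (t : ι → T) :
    HasAllMoments P (fun ω => ∑ i, (realHermite q).eval (Y (t i) ω)) :=
  .sum _ fun i _ => (h.hasAllMoments (t i)).polynomial_eval _

theorem integral_sum (h : IsUnitGaussianFamily P Y r) {q : ℕ} (hq : 1 ≤ q) (t : ι → T) :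
    ∫ ω, ∑ i, (realHermite q).eval (Y (t i) ω) ∂P = 0 := by
  rw [integral_finsetSum _ fun i _ => ((h.hasAllMoments (t i)).polynomial_eval _).integrable]
  refine Finset.sum_eq_zero fun i _ => ?_
  rw [h.integral_realHermite, if_neg (by omega)]

theorem integral_sum_sq (h : IsUnitGaussianFamily P Y r) (q : ℕ) (t : ι → T) :
    ∫ ω, (∑ i, (realHermite q).eval (Y (t i) ω)) ^ 2 ∂P =
      q.factorial * ∑ i, ∑ j, r (t i) (t j) ^ q := by
  have hH : ∀ i, HasAllMoments P (fun ω => (realHermite q).eval (Y (t i) ω)) := fun i =>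
    (h.hasAllMoments (t i)).polynomial_eval _
  simp only [pow_two, Finset.sum_mul_sum]
  rw [integral_finsetSum _ fun i _ => (HasAllMoments.sum _ fun j _ => (hH i).mul (hH j)).integrable,
    Finset.mul_sum]
  refine Finset.sum_congr rfl fun i _ => ?_
  rw [integral_finsetSum _ fun j _ => ((hH i).mul (hH j)).integrable, Finset.mul_sum]
  refine Finset.sum_congr rfl fun j _ => ?_
  rw [h.integral_realHermite_two, if_pos rfl]

theorem integral_sum_pow_four (h : IsUnitGaussianFamily P Y r) (q : ℕ) (t : ι → T) :
    ∫ ω, (∑ i, (realHermite q).eval (Y (t i) ω)) ^ 4 ∂P =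
      ∑ x ∈ antidiagonal q, ∑ y ∈ antidiagonal x.2,
        diagramCoeff q x.1 y.1 y.2 * quadSum (fun i j => r (t i) (t j)) x.1 y.1 y.2 := by
  have hH : ∀ i, HasAllMoments P (fun ω => (realHermite q).eval (Y (t i) ω)) := fun i =>
    (h.hasAllMoments (t i)).polynomial_eval _
  have h4 : ∀ z : ι → ℝ, (∑ i, z i) ^ 4 = ∑ i, ∑ j, ∑ k, ∑ l, z i * (z j * (z k * z l)) := by
    intro z
    simp only [← Finset.mul_sum, ← Finset.sum_mul]
    ring
  simp only [h4]
  rw [integral_finsetSum _ fun i _ => (HasAllMoments.sum _ fun j _ => .sum _ fun k _ =>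
    .sum _ fun l _ => (hH i).mul ((hH j).mul ((hH k).mul (hH l)))).integrable]
  simp only [quadSum, Finset.mul_sum]
  have swap : ∀ g : ℕ × ℕ → ℕ × ℕ → ι → ℝ,
      ∑ x ∈ antidiagonal q, ∑ y ∈ antidiagonal x.2, ∑ i, g x y i =
        ∑ i, ∑ x ∈ antidiagonal q, ∑ y ∈ antidiagonal x.2, g x y i := fun g => by
    rw [Finset.sum_comm]
    exact Finset.sum_congr rfl fun x _ => Finset.sum_comm
  rw [swap]
  refine Finset.sum_congr rfl fun i _ => ?_
  rw [swap]
  rw [integral_finsetSum _ fun j _ => (HasAllMoments.sum _ fun k _ =>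
    .sum _ fun l _ => (hH i).mul ((hH j).mul ((hH k).mul (hH l)))).integrable]
  refine Finset.sum_congr rfl fun j _ => ?_
  rw [swap]
  rw [integral_finsetSum _ fun k _ => (HasAllMoments.sum _ fun l _ =>
    (hH i).mul ((hH j).mul ((hH k).mul (hH l)))).integrable]
  refine Finset.sum_congr rfl fun k _ => ?_
  rw [swap]
  rw [integral_finsetSum _ fun l _ => ((hH i).mul ((hH j).mul ((hH k).mul (hH l)))).integrable]
  refine Finset.sum_congr rfl fun l _ => ?_
  rw [h.integral_realHermite_four]

end IsUnitGaussianFamily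

namespace BreuerMajor

variable {Ω : Type*} [MeasurableSpace Ω] {P : Measure Ω}
  {X : ℤ → Ω → ℝ} {ρ : ℤ → ℝ}

/-- The Toeplitz matrix `(ρ(i - j))_{i, j < n}`. -/
def toeplitz (ρ : ℤ → ℝ) (n : ℕ) (i j : Fin n) : ℝ := ρ ((i : ℤ) - (j : ℤ))

namespace IsStationaryGaussianSeq

theorem isUnitGaussianFamily (h : IsStationaryGaussianSeq P X ρ) :
    IsUnitGaussianFamily P X (fun k l => ρ (k - l)) :=
  ⟨h.gaussian, h.centered, h.cov_eq, fun t => by simpa using h.unit_variance⟩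

theorem neg (h : IsStationaryGaussianSeq P X ρ) (k : ℤ) : ρ (-k) = ρ k := by
  simpa using h.isUnitGaussianFamily.symm 0 k

theorem V_eq {Ω : Type*} {X : ℤ → Ω → ℝ} (q n : ℕ) : V q X n =
    fun ω => (1 / √n) * ∑ i : Fin n, (realHermite q).eval (X ((i : ℕ) : ℤ) ω) := by
  ext ω
  rw [V, Finset.sum_range]
  simp only [eval_realHermite]

theorem v_eq [IsProbabilityMeasure P] (h : IsStationaryGaussianSeq P X ρ) (q n : ℕ) :
    v q P X n = q.factorial / n * ∑ i, ∑ j, toeplitz ρ n i j ^ q := by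
  rw [v, V_eq]
  simp only [mul_pow]
  rw [integral_const_mul, h.isUnitGaussianFamily.integral_sum_sq q (fun i : Fin n => ((i : ℕ) : ℤ))]
  rw [div_pow, one_pow, Real.sq_sqrt (by positivity)]
  simp only [toeplitz]
  ring

theorem cumulant_F [IsProbabilityMeasure P] (h : IsStationaryGaussianSeq P X ρ) {q : ℕ}
    (hq : 1 ≤ q) (n : ℕ) (hv : 0 < v q P X n) :
    cumulant P (F q P X n) 4 = connectedSum q (toeplitz ρ n) / ((v q P X n) ^ 2 * n ^ 2) := by
  have hG := h.isUnitGaussianFamily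
  set t : Fin n → ℤ := fun i => ((i : ℕ) : ℤ) with ht
  set U : Ω → ℝ := fun ω => ∑ i, (realHermite q).eval (X (t i) ω) with hU
  set c : ℝ := 1 / √n * (1 / √(v q P X n)) with hc
  have hF : F q P X n = fun ω => c * U ω := by
    ext ω; rw [F, V_eq]; simp only [hc, hU, ht]; ring
  have hm : HasAllMoments P U := hG.hasAllMoments_sum q t
  rw [cumulant_four (by rw [hF]; simpa using hm.const_mul c 4)
    (by rw [hF, integral_const_mul, hG.integral_sum hq, mul_zero]), hF]
  simp only [mul_pow]
  rw [integral_const_mul, integral_const_mul, hG.integral_sum_pow_four, hG.integral_sum_sq,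
    sum_diagrams_eq _ hq]
  have hc2 : c ^ 2 = 1 / (v q P X n * n) := by
    rw [hc, mul_pow, div_pow, div_pow, Real.sq_sqrt (by positivity), Real.sq_sqrt hv.le]
    ring
  rw [show c ^ 4 = (c ^ 2) ^ 2 by ring, hc2]
  rw [show toeplitz ρ n = fun i j => ρ (t i - t j) from rfl]
  ring

end IsStationaryGaussianSeq

end BreuerMajor

end

/-! ### Positivity for positive semidefinite matrices. -/

section

open Polynomial Finset.HasAntidiagonal

namespace Matrix

variable {ι : Type*} [Fintype ι]

theorem PosSemidef.sum_mul_mul_nonneg {M : Matrix ι ι ℝ} (hM : M.PosSemidef) (c : ι → ℝ) :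
    0 ≤ ∑ i, ∑ j, c i * c j * M i j := by
  have := hM.dotProduct_mulVec_nonneg c
  simp only [dotProduct, mulVec, Finset.mul_sum, star_trivial] at this
  refine this.trans_eq (Finset.sum_congr rfl fun _ _ => Finset.sum_congr rfl fun _ _ => ?_)
  ring

theorem posSemidef_of_sum_nonneg {M : Matrix ι ι ℝ} (hs : ∀ i j, M i j = M j i)
    (h : ∀ c : ι → ℝ, 0 ≤ ∑ i, ∑ j, c i * c j * M i j) : M.PosSemidef := by
  refine .of_dotProduct_mulVec_nonneg (IsHermitian.ext fun i j => by simp [hs i j]) fun c => ?_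
  simp only [dotProduct, mulVec, Finset.mul_sum, star_trivial]
  refine (h c).trans_eq (Finset.sum_congr rfl fun _ _ => Finset.sum_congr rfl fun _ _ => ?_)
  ring

/-- Entrywise powers of a positive semidefinite matrix are positive semidefinite. -/
theorem PosSemidef.entrywise_pow {M : Matrix ι ι ℝ} (hM : M.PosSemidef) (n : ℕ) :
    (of fun i j => M i j ^ n).PosSemidef := by
  induction n with
  | zero =>
    refine posSemidef_of_sum_nonneg (fun _ _ => by simp) fun c => ?_
    simp only [of_apply, pow_zero, mul_one, ← Finset.sum_mul_sum]
    exact mul_self_nonneg _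
  | succ n ih =>
    have h : (of fun i j => M i j ^ (n + 1)) = (of fun i j => M i j ^ n) ⊙ M := by
      ext i j; simp [pow_succ]
    rw [h]
    exact ih.hadamard hM

open scoped MatrixOrder in
/-- For positive semidefinite `B` and symmetric `C`, `tr(BCBC)` is the sum of the squares of the
entries of a symmetric matrix with trace `tr(BC)`. -/
theorem PosSemidef.exists_sum_sq_eq {B C : Matrix ι ι ℝ} (hB : B.PosSemidef)
    (hC : ∀ i j, C i j = C j i) :
    ∃ M : Matrix ι ι ℝ, ∑ i, ∑ j, M i j ^ 2 =
        ∑ i, ∑ j, ∑ k, ∑ l, B i k * B j l * (C i l * C j k) ∧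
      ∑ i, M i i = ∑ i, ∑ j, B i j * C i j := by
  classical
  obtain ⟨L, rfl⟩ := CStarAlgebra.nonneg_iff_eq_star_mul_self.mp hB.nonneg
  have hCt : Cᵀ = C := by ext i j; exact hC j i
  have hstar : star L = Lᵀ := by rw [star_eq_conjTranspose, conjTranspose_eq_transpose_of_trivial]
  rw [hstar]
  set B := Lᵀ * L with hBdef
  have hBt : Bᵀ = B := by simp [hBdef]
  -- With `B = Lᵀ L`, both identities for `L C Lᵀ` follow from cyclicity of the trace.
  refine ⟨L * C * Lᵀ, ?_, ?_⟩
  · have h1 : ∑ i, ∑ j, (L * C * Lᵀ) i j ^ 2 = trace ((L * C * Lᵀ) * (L * C * Lᵀ)ᵀ) := by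
      simp only [trace, diag, mul_apply (M := L * C * Lᵀ), transpose_apply, pow_two]
    have h2 : ((L * C * Lᵀ) * (L * C * Lᵀ)ᵀ) = L * (C * B * C * Lᵀ) := by
      simp only [transpose_mul, transpose_transpose, hCt, hBdef, Matrix.mul_assoc]
    rw [h1, h2, trace_mul_comm, Matrix.mul_assoc _ Lᵀ L, ← hBdef]
    have h3 : trace (C * B * C * B) = trace ((B * C) * (B * C)) := by
      rw [trace_mul_comm]
      simp only [Matrix.mul_assoc]
    rw [h3]
    simp only [trace, diag, mul_apply, Finset.sum_mul_sum]
    refine Finset.sum_congr rfl fun i _ => Finset.sum_congr rfl fun j _ =>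
      Finset.sum_congr rfl fun k _ => Finset.sum_congr rfl fun l _ => ?_
    rw [hC k j, hC l i]
    ring
  · have : ∑ i, (L * C * Lᵀ) i i = trace (L * C * Lᵀ) := rfl
    rw [this, Matrix.mul_assoc, trace_mul_comm, Matrix.mul_assoc, ← hBdef, trace_mul_comm]
    simp only [trace, diag, mul_apply]
    refine Finset.sum_congr rfl fun i _ => Finset.sum_congr rfl fun j _ => ?_
    rw [hC j i]

end Matrix

section Kernel

/-- A coefficient of a polynomial of bounded degree is a linear combination of its values. -/
theorem Polynomial.exists_coeff_eq_sum_eval (N m : ℕ) :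
    ∃ w : Fin N → ℝ, ∀ p : ℝ[X], p.natDegree < N → p.coeff m = ∑ i, w i * p.eval ((i : ℕ) : ℝ) := by
  have hinj : Set.InjOn (fun i : Fin N => ((i : ℕ) : ℝ)) (Finset.univ : Finset (Fin N)) := by
    intro a _ b _ h
    exact Fin.ext (Nat.cast_injective (R := ℝ) h)
  refine ⟨fun i => (Lagrange.basis Finset.univ (fun i : Fin N => ((i : ℕ) : ℝ)) i).coeff m,
    fun p hp => ?_⟩
  have hd : p.degree < (Finset.univ : Finset (Fin N)).card := by
    simpa using degree_le_natDegree.trans_lt (Nat.cast_lt.2 hp)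
  conv_lhs => rw [Lagrange.eq_interpolate hinj hd, Lagrange.interpolate_apply, finsetSum_coeff]
  refine Finset.sum_congr rfl fun i _ => ?_
  rw [coeff_C_mul, mul_comm]

theorem Polynomial.coeff_C_add_C_mul_X_pow (a b : ℝ) (n k : ℕ) :
    ((C a + C b * X) ^ n).coeff k = n.choose k * (a ^ (n - k) * b ^ k) := by
  rcases Nat.lt_or_ge n k with h | h
  · rw [Nat.choose_eq_zero_of_lt h, Nat.cast_zero, zero_mul]
    refine coeff_eq_zero_of_natDegree_lt (lt_of_le_of_lt ?_ h)
    compute_degree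
  · rw [add_comm, add_pow, finsetSum_coeff, Finset.sum_eq_single k]
    · rw [mul_pow, ← C_pow, ← C_pow, ← map_natCast (C : ℝ →+* ℝ[X]),
        show C (b ^ k) * X ^ k * C (a ^ (n - k)) * C (n.choose k : ℝ) =
          C (n.choose k * (a ^ (n - k) * b ^ k)) * X ^ k by simp only [map_mul]; ring,
        coeff_C_mul_X_pow, if_pos rfl]
    · intro l _ hl
      rw [mul_pow, ← C_pow, ← C_pow, ← map_natCast (C : ℝ →+* ℝ[X]),
        show C (b ^ l) * X ^ l * C (a ^ (n - l)) * C (n.choose l : ℝ) =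
          C (n.choose l * (a ^ (n - l) * b ^ l)) * X ^ l by simp only [map_mul]; ring,
        coeff_C_mul_X_pow, if_neg hl.symm]
    · intro hk; simp at hk; omega

variable {ι : Type*} [Fintype ι]

/-- Polarisation. If `R` is the Gram matrix of vectors `x_i`, then `⟨x_i + s x_j, x_k + t x_l⟩ ^
(2m)` is a positive semidefinite kernel in `(i, j, s)`, `(k, l, t)`. Up to the factor `(2m).choose
m`, the kernel in question is its coefficient of `s^m t^m`. Extracting a coefficient is a fixed
linear combination of evaluations, applied on both sides, so positivity survives. -/
theorem sum_diagram_kernel_nonneg {R : Matrix ι ι ℝ} (hR : R.PosSemidef) (m : ℕ)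
    (c : ι → ι → ℝ) :
    0 ≤ ∑ i, ∑ j, ∑ k, ∑ l, c i j * c k l * ∑ y ∈ antidiagonal m,
      (m.choose y.1 : ℝ) * (m.choose y.2) * ((R i k * R j l) ^ y.1 * (R i l * R j k) ^ y.2) := by
  classical
  obtain ⟨w, hw⟩ := Polynomial.exists_coeff_eq_sum_eval (2 * m + 1) m
  -- The column of `B` at `(i, j, s)` represents `x_i + s x_j`. The nodes `s = 0, …, 2m` suffice
  -- because the polynomials have degree at most `2m`.
  set B : Matrix ι (ι × ι × Fin (2 * m + 1)) ℝ := Matrix.of fun u p =>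
    (if u = p.1 then 1 else 0) + (p.2.2 : ℕ) * (if u = p.2.1 then 1 else 0) with hB
  set G : Matrix (ι × ι × Fin (2 * m + 1)) (ι × ι × Fin (2 * m + 1)) ℝ :=
    B.conjTranspose * R * B with hGdef
  have hG : G.PosSemidef := hR.conjTranspose_mul_mul_same B
  have hGe : ∀ p p', G p p' = R p.1 p'.1 + (p'.2.2 : ℕ) * R p.1 p'.2.1 +
      (p.2.2 : ℕ) * (R p.2.1 p'.1 + (p'.2.2 : ℕ) * R p.2.1 p'.2.1) := by
    intro p p'
    simp only [hGdef, hB, Matrix.mul_apply, Matrix.conjTranspose_apply, Matrix.of_apply,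
      star_trivial, add_mul, mul_add, Finset.sum_add_distrib, mul_ite, ite_mul, mul_one, one_mul,
      mul_zero, zero_mul, Finset.sum_ite_eq', Finset.mem_univ, if_true]
    ring
  -- The weights `w` extract the coefficient of order `m` in `s` and in `t` at once.
  have hpow := (hG.entrywise_pow (2 * m)).sum_mul_mul_nonneg (fun p => c p.1 p.2.1 * w p.2.2)
  have hdeg : ∀ (n : ℕ) (a b : ℝ), ((C a + C b * X) ^ n).natDegree ≤ n := fun n a b => by
    compute_degree
  have hinner : ∀ i j k l, ∑ s, ∑ t, w s * w t * G (i, j, s) (k, l, t) ^ (2 * m) =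
      (2 * m).choose m * ∑ y ∈ antidiagonal m,
      (m.choose y.1 : ℝ) * (m.choose y.2) * ((R i k * R j l) ^ y.1 * (R i l * R j k) ^ y.2) := by
    intro i j k l
    have h1 : ∀ s : Fin (2 * m + 1), ∑ t, w t * G (i, j, s) (k, l, t) ^ (2 * m) =
        (2 * m).choose m * ((C (R i k) + C (R j k) * X) ^ m *
          (C (R i l) + C (R j l) * X) ^ m).eval ((s : ℕ) : ℝ) := by
      intro s
      have := hw ((C (R i k + (s : ℕ) * R j k) + C (R i l + (s : ℕ) * R j l) * X) ^ (2 * m))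
        (Nat.lt_succ_of_le (hdeg _ _ _))
      rw [Polynomial.coeff_C_add_C_mul_X_pow, show 2 * m - m = m by omega] at this
      simp only [eval_mul, eval_pow, eval_add, eval_C, eval_X] at this ⊢
      rw [mul_comm (R j k), mul_comm (R j l), this]
      refine Finset.sum_congr rfl fun t _ => ?_
      rw [hGe]
      ring
    have h2 : ((C (R i k) + C (R j k) * X) ^ m * (C (R i l) + C (R j l) * X) ^ m).natDegree <
        2 * m + 1 := by
      have := natDegree_mul_le_of_le (hdeg m (R i k) (R j k)) (hdeg m (R i l) (R j l))
      omega
    calc _ = ∑ s, w s * ∑ t, w t * G (i, j, s) (k, l, t) ^ (2 * m) := by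
          simp only [Finset.mul_sum, mul_assoc]
      _ = (2 * m).choose m * ((C (R i k) + C (R j k) * X) ^ m *
          (C (R i l) + C (R j l) * X) ^ m).coeff m := by
          rw [hw _ h2, Finset.mul_sum]
          refine Finset.sum_congr rfl fun s _ => ?_
          rw [h1]; ring
      _ = _ := by
          rw [coeff_mul, ← Finset.Nat.sum_antidiagonal_swap]
          congr 1
          refine Finset.sum_congr rfl ?_
          rintro ⟨b, d⟩ hy
          rw [mem_antidiagonal] at hy
          simp only [Polynomial.coeff_C_add_C_mul_X_pow, Prod.fst_swap, Prod.snd_swap] at hy ⊢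
          rw [show m - d = b by omega, show m - b = d by omega]
          simp only [mul_pow]
          ring
  have hpos : (0 : ℝ) < (2 * m).choose m := by exact_mod_cast Nat.choose_pos (by omega)
  refine (mul_nonneg_iff_of_pos_left hpos).1 ?_
  refine hpow.trans_eq ?_
  simp only [Matrix.of_apply, Fintype.sum_prod_type, Finset.mul_sum (Finset.univ)]
  refine Finset.sum_congr rfl fun i _ => Finset.sum_congr rfl fun j _ => ?_
  rw [Finset.sum_comm]
  refine Finset.sum_congr rfl fun k _ => ?_
  rw [Finset.sum_comm]
  refine Finset.sum_congr rfl fun l _ => ?_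
  rw [mul_left_comm, ← hinner, Finset.mul_sum]
  refine Finset.sum_congr rfl fun s _ => ?_
  rw [Finset.mul_sum]
  refine Finset.sum_congr rfl fun t _ => ?_
  ring

end Kernel

end

/-! ### Lower and upper bounds for the connected sum. -/

section

open Polynomial Finset.HasAntidiagonal

section

variable {ι : Type*} [Fintype ι]

theorem diagramCoeff_pos (q a b c : ℕ) : 0 < diagramCoeff q a b c := by
  unfold diagramCoeff; positivity

/-- With `B` and `C` the entrywise `b`-th and `c`-th powers of `R`, this sum is `tr(BCBC)`. Since
`B` is positive semidefinite, it is a sum of squares. -/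
theorem quadSum_zero_nonneg {R : Matrix ι ι ℝ} (hR : R.PosSemidef) (b c : ℕ) :
    0 ≤ quadSum R 0 b c := by
  have hs : ∀ i j, R i j = R j i := fun i j => by simpa using (hR.isHermitian.apply i j).symm
  obtain ⟨M, hM, -⟩ := (hR.entrywise_pow b).exists_sum_sq_eq
    (C := Matrix.of fun i j => R i j ^ c) (fun i j => by simp [hs i j])
  have : quadSum R 0 b c = ∑ i, ∑ j, M i j ^ 2 := by
    rw [hM]; simp only [quadSum, Matrix.of_apply, mul_pow, pow_zero, one_mul]
  rw [this]
  positivity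

/-- The left side is the squared trace of the matrix `M` whose squared entries sum to `quadSum R 0 b
c`. Apply Cauchy-Schwarz to the diagonal of `M` and drop the other entries. -/
theorem sq_sum_pow_le_card_mul_quadSum {R : Matrix ι ι ℝ} (hR : R.PosSemidef) (b c : ℕ) :
    (∑ i, ∑ j, R i j ^ (b + c)) ^ 2 ≤ Fintype.card ι * quadSum R 0 b c := by
  have hs : ∀ i j, R i j = R j i := fun i j => by simpa using (hR.isHermitian.apply i j).symm
  obtain ⟨M, hM, htr⟩ := (hR.entrywise_pow b).exists_sum_sq_eq
    (C := Matrix.of fun i j => R i j ^ c) (fun i j => by simp [hs i j])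
  have h1 : quadSum R 0 b c = ∑ i, ∑ j, M i j ^ 2 := by
    rw [hM]; simp only [quadSum, Matrix.of_apply, mul_pow, pow_zero, one_mul]
  have h2 : ∑ i, ∑ j, R i j ^ (b + c) = ∑ i, M i i := by
    rw [htr]; simp only [Matrix.of_apply, pow_add]
  rw [h1, h2]
  refine (sq_sum_le_card_mul_sum_sq (s := Finset.univ)).trans ?_
  rw [Finset.card_univ]
  refine mul_le_mul_of_nonneg_left (Finset.sum_le_sum fun i _ => ?_) (by positivity)
  exact Finset.single_le_sum (f := fun j => M i j ^ 2) (fun j _ => sq_nonneg _) (Finset.mem_univ i)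

/-- For fixed `a` and `b + c = m`, `diagramCoeff` is a constant times `m.choose b * m.choose c`.
Thus the sum is the polarised kernel tested against `R i j ^ a`. -/
theorem sum_diagramCoeff_mul_quadSum_nonneg {R : Matrix ι ι ℝ} (hR : R.PosSemidef) (q a m : ℕ) :
    0 ≤ ∑ y ∈ antidiagonal m, diagramCoeff q a y.1 y.2 * quadSum R a y.1 y.2 := by
  have key := sum_diagram_kernel_nonneg hR m (fun i j => R i j ^ a)
  set K : ℝ := (q.factorial : ℝ) ^ 4 / ((a.factorial : ℝ) * m.factorial) ^ 2 with hK
  refine (mul_nonneg (a := K) (by positivity) key).trans_eq ?_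
  have swap : ∀ g : ι → ℕ × ℕ → ℝ,
      ∑ i, ∑ y ∈ antidiagonal m, g i y = ∑ y ∈ antidiagonal m, ∑ i, g i y :=
    fun g => Finset.sum_comm
  simp only [quadSum, Finset.mul_sum]
  simp only [swap]
  refine Finset.sum_congr rfl ?_
  rintro ⟨b, c⟩ hy
  rw [mem_antidiagonal] at hy
  simp only at hy ⊢
  subst hy
  refine Finset.sum_congr rfl fun i _ => Finset.sum_congr rfl fun j _ =>
    Finset.sum_congr rfl fun k _ => Finset.sum_congr rfl fun l _ => ?_
  have e2 := Nat.cast_choose_add c b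
  rw [add_comm c b] at e2
  rw [Nat.cast_choose_add, e2, hK, diagramCoeff]
  simp only [mul_pow]
  field_simp

/-- For a positive semidefinite matrix the connected diagrams have a nonnegative sum, bounded below
by the contribution of a single contraction. -/
theorem le_connectedSum {R : Matrix ι ι ℝ} (hR : R.PosSemidef) {q : ℕ} (hq : 2 ≤ q) :
    diagramCoeff q 0 1 (q - 1) * quadSum R 0 1 (q - 1) ≤ connectedSum q R := by
  set f : ℕ × ℕ → ℕ × ℕ → ℝ := fun x y => if x.1 = q ∨ y.1 = q ∨ y.2 = q then 0 else
      diagramCoeff q x.1 y.1 y.2 * quadSum R x.1 y.1 y.2 with hf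
  -- For `a = 0` each term is nonnegative by itself, so one of them can be singled out. For `0 < a <
  -- q` only the sum over `b + c` is known to be nonnegative.
  have h0 : ∀ y, 0 ≤ f (0, q) y := by
    intro y
    simp only [hf]
    split_ifs
    · exact le_rfl
    · exact mul_nonneg (diagramCoeff_pos _ _ _ _).le (quadSum_zero_nonneg hR _ _)
  have hx : ∀ x ∈ antidiagonal q, 0 ≤ ∑ y ∈ antidiagonal x.2, f x y := by
    rintro ⟨a, m⟩ hx
    rw [mem_antidiagonal] at hx
    simp only at hx
    rcases Nat.eq_zero_or_pos a with rfl | ha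
    · obtain rfl : m = q := by omega
      exact Finset.sum_nonneg fun y _ => h0 y
    · by_cases haq : a = q
      · simp [hf, haq]
      · refine (sum_diagramCoeff_mul_quadSum_nonneg hR q a m).trans_eq ?_
        refine Finset.sum_congr rfl fun y hy => ?_
        rw [mem_antidiagonal] at hy
        simp only [hf]
        rw [if_neg (by omega)]
  calc _ = f (0, q) (1, q - 1) := by simp only [hf]; rw [if_neg (by omega)]
    _ ≤ ∑ y ∈ antidiagonal q, f (0, q) y :=
        Finset.single_le_sum (f := f (0, q)) (fun y _ => h0 y)
          (by rw [mem_antidiagonal]; simp only; omega)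
    _ ≤ ∑ x ∈ antidiagonal q, ∑ y ∈ antidiagonal x.2, f x y :=
        Finset.single_le_sum (f := fun x => ∑ y ∈ antidiagonal x.2, f x y) hx
          (by simp : ((0, q) : ℕ × ℕ) ∈ antidiagonal q)

theorem sum_four_comm₁₂ (f : ι → ι → ι → ι → ℝ) :
    ∑ i, ∑ j, ∑ k, ∑ l, f i j k l = ∑ i, ∑ j, ∑ k, ∑ l, f j i k l := Finset.sum_comm

theorem sum_four_comm₂₃ (f : ι → ι → ι → ι → ℝ) :
    ∑ i, ∑ j, ∑ k, ∑ l, f i j k l = ∑ i, ∑ j, ∑ k, ∑ l, f i k j l :=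
  Finset.sum_congr rfl fun _ _ => Finset.sum_comm

theorem sum_four_comm₃₄ (f : ι → ι → ι → ι → ℝ) :
    ∑ i, ∑ j, ∑ k, ∑ l, f i j k l = ∑ i, ∑ j, ∑ k, ∑ l, f i j l k :=
  Finset.sum_congr rfl fun _ _ => Finset.sum_congr rfl fun _ _ => Finset.sum_comm

theorem quadSum_comm₁₂ {R : ι → ι → ℝ} (hs : ∀ i j, R i j = R j i) (a b c : ℕ) :
    quadSum R a b c = quadSum R b a c := by
  rw [quadSum, sum_four_comm₂₃, quadSum]
  refine Finset.sum_congr rfl fun i _ => Finset.sum_congr rfl fun j _ =>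
    Finset.sum_congr rfl fun k _ => Finset.sum_congr rfl fun l _ => ?_
  rw [hs k j]; ring

theorem quadSum_comm₂₃ {R : ι → ι → ℝ} (hs : ∀ i j, R i j = R j i) (a b c : ℕ) :
    quadSum R a b c = quadSum R a c b := by
  rw [quadSum, sum_four_comm₃₄, quadSum]
  refine Finset.sum_congr rfl fun i _ => Finset.sum_congr rfl fun j _ =>
    Finset.sum_congr rfl fun k _ => Finset.sum_congr rfl fun l _ => ?_
  rw [hs k l]; ring

/-- Exponents are shifted towards the larger variables. Since `a < q`, one factor can be kept as
`v`. -/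
theorem mul_pow_le_of_sorted {u v w : ℝ} (hw : 0 ≤ w) (hwv : w ≤ v) (hvu : v ≤ u) {q a b c : ℕ}
    (ha : a < q) (h : a + b + c = q) : u ^ a * v ^ b * w ^ c ≤ u ^ (q - 1) * v := by
  have hv : 0 ≤ v := hw.trans hwv
  have hu : 0 ≤ u := hv.trans hvu
  obtain ⟨d, hd⟩ : ∃ d, b + c = d + 1 := ⟨b + c - 1, by omega⟩
  calc u ^ a * v ^ b * w ^ c ≤ u ^ a * v ^ b * v ^ c := by gcongr
    _ = u ^ a * v ^ d * v := by rw [mul_assoc, ← pow_add, hd, pow_succ, mul_assoc]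
    _ ≤ u ^ a * u ^ d * v := by gcongr
    _ = u ^ (q - 1) * v := by rw [← pow_add]; congr 2; omega

theorem mul_pow_le_sum_perm {u v w : ℝ} (hu : 0 ≤ u) (hv : 0 ≤ v) (hw : 0 ≤ w) {q a b c : ℕ}
    (ha : a < q) (hb : b < q) (hc : c < q) (h : a + b + c = q) :
    u ^ a * v ^ b * w ^ c ≤ u ^ (q - 1) * v + u ^ (q - 1) * w + v ^ (q - 1) * u +
      v ^ (q - 1) * w + w ^ (q - 1) * u + w ^ (q - 1) * v := by
  have h1 : 0 ≤ u ^ (q - 1) * v := by positivity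
  have h2 : 0 ≤ u ^ (q - 1) * w := by positivity
  have h3 : 0 ≤ v ^ (q - 1) * u := by positivity
  have h4 : 0 ≤ v ^ (q - 1) * w := by positivity
  have h5 : 0 ≤ w ^ (q - 1) * u := by positivity
  have h6 : 0 ≤ w ^ (q - 1) * v := by positivity
  rcases le_total u v with h7 | h7 <;> rcases le_total v w with h8 | h8 <;>
    rcases le_total u w with h9 | h9
  · have := mul_pow_le_of_sorted hu h7 h8 hc (show c + b + a = q by omega); linarith
  · have := mul_pow_le_of_sorted hu h7 h8 hc (show c + b + a = q by omega); linarith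
  · have := mul_pow_le_of_sorted hu h9 h8 hb (show b + c + a = q by omega); linarith
  · have := mul_pow_le_of_sorted hw h9 h7 hb (show b + a + c = q by omega); linarith
  · have := mul_pow_le_of_sorted hv h7 h9 hc (show c + a + b = q by omega); linarith
  · have := mul_pow_le_of_sorted hv h8 h9 ha (show a + c + b = q by omega); linarith
  · have := mul_pow_le_of_sorted hw h8 h7 ha (show a + b + c = q by omega); linarith
  · have := mul_pow_le_of_sorted hw h8 h7 ha (show a + b + c = q by omega); linarith

/-- The order of the three edge products varies with the indices, so all six orderings are added.
Relabelling the vertices makes the six sums equal. -/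
theorem quadSum_le {R : ι → ι → ℝ} (hs : ∀ i j, R i j = R j i) {q a b c : ℕ}
    (ha : a < q) (hb : b < q) (hc : c < q) (h : a + b + c = q) :
    quadSum R a b c ≤ 6 * quadSum (fun i j => |R i j|) (q - 1) 1 0 := by
  have hs' : ∀ i j, |R i j| = |R j i| := fun i j => by rw [hs]
  set A : ι → ι → ℝ := fun i j => |R i j| with hA
  have e1 := quadSum_comm₂₃ hs' (q - 1) 0 1
  have e2 := quadSum_comm₁₂ hs' 1 (q - 1) 0
  have e3 := (quadSum_comm₁₂ hs' 0 (q - 1) 1).trans e1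
  have e4 := (quadSum_comm₂₃ hs' 1 0 (q - 1)).trans e2
  have e5 := (quadSum_comm₂₃ hs' 0 1 (q - 1)).trans e3
  rw [← hA] at e1 e2 e3 e4 e5
  have : 6 * quadSum A (q - 1) 1 0 = quadSum A (q - 1) 1 0 + quadSum A (q - 1) 0 1 +
      quadSum A 1 (q - 1) 0 + quadSum A 0 (q - 1) 1 + quadSum A 1 0 (q - 1) +
      quadSum A 0 1 (q - 1) := by
    rw [e1, e2, e3, e4, e5]; ring
  rw [this]
  simp only [quadSum, ← Finset.sum_add_distrib]
  refine Finset.sum_le_sum fun i _ => Finset.sum_le_sum fun j _ =>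
    Finset.sum_le_sum fun k _ => Finset.sum_le_sum fun l _ => ?_
  refine (le_abs_self _).trans ?_
  have := mul_pow_le_sum_perm (mul_nonneg (abs_nonneg (R i j)) (abs_nonneg (R k l)))
    (mul_nonneg (abs_nonneg (R i k)) (abs_nonneg (R j l)))
    (mul_nonneg (abs_nonneg (R i l)) (abs_nonneg (R j k))) ha hb hc h
  simp only [abs_mul, abs_pow, hA, pow_zero, pow_one, mul_one, one_mul]
  linarith

theorem exists_connectedSum_le (q : ℕ) : ∃ C : ℝ, 0 < C ∧ ∀ {ι : Type} [Fintype ι]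
    (R : ι → ι → ℝ), (∀ i j, R i j = R j i) →
    connectedSum q R ≤ C * quadSum (fun i j => |R i j|) (q - 1) 1 0 := by
  refine ⟨∑ x ∈ antidiagonal q, ∑ y ∈ antidiagonal x.2, diagramCoeff q x.1 y.1 y.2 * 6, ?_, ?_⟩
  · refine Finset.sum_pos (fun x _ => Finset.sum_pos (fun y _ => ?_) ⟨(0, x.2), by simp⟩)
      ⟨(0, q), by simp⟩
    exact mul_pos (diagramCoeff_pos _ _ _ _) (by norm_num)
  · intro ι _ R hs
    rw [connectedSum, Finset.sum_mul]
    refine Finset.sum_le_sum fun x hx => ?_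
    rw [Finset.sum_mul]
    refine Finset.sum_le_sum fun y hy => ?_
    rw [mem_antidiagonal] at hx hy
    have hQ : 0 ≤ quadSum (fun i j => |R i j|) (q - 1) 1 0 := by unfold quadSum; positivity
    split_ifs with h
    · exact mul_nonneg (mul_nonneg (diagramCoeff_pos _ _ _ _).le (by norm_num)) hQ
    · rw [mul_assoc]
      exact mul_le_mul_of_nonneg_left (quadSum_le hs (by omega) (by omega) (by omega) (by omega))
        (diagramCoeff_pos _ _ _ _).le

/-- A sum over paths of length three is bounded by the product of bounds on the row sums. -/
theorem sum_path_le {f g h : ι → ι → ℝ} {A B D : ℝ} (hf : ∀ i j, 0 ≤ f i j) (hg : ∀ i j, 0 ≤ g i j)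
    (hA : ∀ i, ∑ j, f i j ≤ A) (hB : ∀ i, ∑ j, g i j ≤ B)
    (hD : ∀ i, ∑ j, h i j ≤ D) (hB0 : 0 ≤ B) (hD0 : 0 ≤ D) :
    ∑ i, ∑ j, ∑ k, ∑ l, f i j * g i k * h k l ≤ Fintype.card ι * (A * B * D) := by
  have h1 : ∀ i, ∑ k, g i k * ∑ l, h k l ≤ B * D := fun i => by
    calc _ ≤ ∑ k, g i k * D :=
          Finset.sum_le_sum fun k _ => mul_le_mul_of_nonneg_left (hD k) (hg i k)
      _ = (∑ k, g i k) * D := by rw [Finset.sum_mul]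
      _ ≤ B * D := mul_le_mul_of_nonneg_right (hB i) hD0
  have h2 : ∀ i, ∑ j, f i j * ∑ k, g i k * ∑ l, h k l ≤ A * (B * D) := fun i => by
    rw [← Finset.sum_mul]
    calc _ ≤ (∑ j, f i j) * (B * D) :=
          mul_le_mul_of_nonneg_left (h1 i) (Finset.sum_nonneg fun j _ => hf i j)
      _ ≤ _ := mul_le_mul_of_nonneg_right (hA i) (by positivity)
  calc _ = ∑ i, ∑ j, f i j * ∑ k, g i k * ∑ l, h k l := by
        simp only [Finset.mul_sum, mul_assoc]
    _ ≤ ∑ i : ι, A * (B * D) := Finset.sum_le_sum fun i _ => h2 i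
    _ = _ := by rw [Finset.sum_const, Finset.card_univ, nsmul_eq_mul]; ring

/-- The inequality `|R i k| * |R j l| ≤ (|R i k|² + |R j l|²) / 2` removes one edge of the 4-cycle.
Two paths remain, each with outer edges to the power `p` and middle edge squared. -/
theorem quadSum_abs_le {R : ι → ι → ℝ} (hs : ∀ i j, R i j = R j i) (p : ℕ) {A B : ℝ}
    (hA : ∀ i, ∑ j, |R i j| ^ p ≤ A) (hB : ∀ i, ∑ j, |R i j| ^ 2 ≤ B) (hA0 : 0 ≤ A) (hB0 : 0 ≤ B) :
    quadSum (fun i j => |R i j|) p 1 0 ≤ Fintype.card ι * (A ^ 2 * B) := by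
  have h1 := sum_path_le (f := fun i j => |R i j| ^ p) (g := fun i j => |R i j| ^ 2)
    (h := fun i j => |R i j| ^ p) (fun _ _ => by positivity) (fun _ _ => by positivity) hA hB hA
    hB0 hA0
  have h2 := h1
  rw [sum_four_comm₁₂, sum_four_comm₃₄] at h2
  have h3 : quadSum (fun i j => |R i j|) p 1 0 ≤ (1 / 2) *
      (∑ i, ∑ j, ∑ k, ∑ l, |R i j| ^ p * |R i k| ^ 2 * |R k l| ^ p) + (1 / 2) *
      (∑ i, ∑ j, ∑ k, ∑ l, |R j i| ^ p * |R j l| ^ 2 * |R l k| ^ p) := by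
    simp only [quadSum, Finset.mul_sum, ← Finset.sum_add_distrib]
    refine Finset.sum_le_sum fun i _ => Finset.sum_le_sum fun j _ =>
      Finset.sum_le_sum fun k _ => Finset.sum_le_sum fun l _ => ?_
    rw [hs j i, hs l k, mul_pow, pow_one, pow_zero, mul_one]
    have h4 : 0 ≤ |R i j| ^ p * |R k l| ^ p := by positivity
    nlinarith [mul_nonneg h4 (sq_nonneg (|R i k| - |R j l|))]
  nlinarith

/-- This is the source of the exponent `4/3`. Put `|R| = t³`; each edge of the 4-cycle lies in three
of the four paths obtained by deleting an edge. The cycle weight is therefore the product of the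
four path weights in `t`, and AM-GM bounds it by path sums of `t⁴ = |R|^(4/3)`. -/
theorem quadSum_abs_one_one_le {R : ι → ι → ℝ} (hs : ∀ i j, R i j = R j i) {A : ℝ}
    (hA : ∀ i, ∑ j, |R i j| ^ (4 / 3 : ℝ) ≤ A) (hA0 : 0 ≤ A) :
    quadSum (fun i j => |R i j|) 1 1 0 ≤ Fintype.card ι * A ^ 3 := by
  set t : ι → ι → ℝ := fun i j => |R i j| ^ (1 / 3 : ℝ) with ht
  have ht0 : ∀ i j, 0 ≤ t i j := fun i j => by positivity
  have hts : ∀ i j, t i j = t j i := fun i j => by simp only [ht, hs i j]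
  have h3 : ∀ i j, |R i j| = t i j ^ 3 := fun i j => by
    simp only [ht]; rw [← Real.rpow_mul_natCast (abs_nonneg _)]; norm_num
  have h4 : ∀ i j, |R i j| ^ (4 / 3 : ℝ) = t i j ^ 4 := fun i j => by
    simp only [ht]; rw [← Real.rpow_mul_natCast (abs_nonneg _)]; norm_num
  simp only [h4] at hA
  have p1 := sum_path_le (f := fun i j => t i j ^ 4) (g := fun i j => t i j ^ 4)
    (h := fun i j => t i j ^ 4) (fun _ _ => by positivity) (fun _ _ => by positivity) hA hA hA
    hA0 hA0
  have p2 := p1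
  rw [sum_four_comm₂₃, sum_four_comm₁₂, sum_four_comm₃₄] at p2
  have p3 := p1
  rw [sum_four_comm₁₂, sum_four_comm₃₄] at p3
  have p4 := p1
  rw [sum_four_comm₁₂, sum_four_comm₃₄, sum_four_comm₂₃] at p4
  have key : quadSum (fun i j => |R i j|) 1 1 0 ≤ (1 / 4) *
      (∑ i, ∑ j, ∑ k, ∑ l, t i j ^ 4 * t i k ^ 4 * t k l ^ 4) + (1 / 4) *
      (∑ i, ∑ j, ∑ k, ∑ l, t j l ^ 4 * t j i ^ 4 * t i k ^ 4) + (1 / 4) *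
      (∑ i, ∑ j, ∑ k, ∑ l, t j i ^ 4 * t j l ^ 4 * t l k ^ 4) + (1 / 4) *
      (∑ i, ∑ j, ∑ k, ∑ l, t k i ^ 4 * t k l ^ 4 * t l j ^ 4) := by
    simp only [quadSum, Finset.mul_sum, ← Finset.sum_add_distrib]
    refine Finset.sum_le_sum fun i _ => Finset.sum_le_sum fun j _ =>
      Finset.sum_le_sum fun k _ => Finset.sum_le_sum fun l _ => ?_
    rw [hts j i, hts l k, hts k i, hts l j, h3, h3, h3, h3]
    have amgm : ∀ x y z w : ℝ, x * y * z * w ≤ (x ^ 4 + y ^ 4 + z ^ 4 + w ^ 4) / 4 := by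
      intro x y z w
      nlinarith [sq_nonneg (x * y - z * w), sq_nonneg (x ^ 2 - y ^ 2), sq_nonneg (z ^ 2 - w ^ 2)]
    have := amgm (t i j * t i k * t k l) (t i j * t i k * t j l) (t i j * t k l * t j l)
      (t i k * t k l * t j l)
    nlinarith [this]
  linarith
end

end

/-! ### Non-degeneracy and cumulant bounds for the stationary sequence. -/

section

open Polynomial Finset.HasAntidiagonal

namespace BreuerMajor

theorem sum_toeplitz_row_le (ρ : ℤ → ℝ) {g : ℝ → ℝ} (hg : ∀ x, 0 ≤ g x) (n : ℕ) (i : Fin n) :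
    ∑ j, g (toeplitz ρ n i j) ≤ ∑ k ∈ Finset.Ioo (-(n : ℤ)) n, g (ρ k) := by
  have hinj : Function.Injective (fun j : Fin n => ((i : ℕ) : ℤ) - ((j : ℕ) : ℤ)) := by
    intro a b h
    simp only [sub_right_inj, Nat.cast_inj] at h
    exact Fin.ext h
  calc _ = ∑ k ∈ Finset.univ.map ⟨_, hinj⟩, g (ρ k) := by
        rw [Finset.sum_map]; rfl
    _ ≤ _ := by
        refine Finset.sum_le_sum_of_subset_of_nonneg ?_ fun _ _ _ => hg _
        intro k hk
        simp only [Finset.mem_map, Finset.mem_univ, Function.Embedding.coeFn_mk, true_and] at hk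
        obtain ⟨j, rfl⟩ := hk
        rw [Finset.mem_Ioo]
        omega

namespace IsStationaryGaussianSeq

variable {Ω : Type*} [MeasurableSpace Ω] {P : Measure Ω} {X : ℤ → Ω → ℝ} {ρ : ℤ → ℝ}

theorem toeplitz_symm (h : IsStationaryGaussianSeq P X ρ) (n : ℕ) (i j : Fin n) :
    toeplitz ρ n i j = toeplitz ρ n j i := by
  rw [toeplitz, toeplitz, ← h.neg, neg_sub]

theorem sum_mul_mul_nonneg [IsProbabilityMeasure P] (h : IsStationaryGaussianSeq P X ρ)
    {ι : Type*} [Fintype ι] (t : ι → ℤ) (c : ι → ℝ) :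
    0 ≤ ∑ i, ∑ j, c i * c j * ρ (t i - t j) := by
  have hm := h.isUnitGaussianFamily.hasAllMoments
  have key : ∫ ω, (∑ i, c i * X (t i) ω) ^ 2 ∂P = ∑ i, ∑ j, c i * c j * ρ (t i - t j) := by
    have e : ∀ ω, (∑ i, c i * X (t i) ω) ^ 2 =
        ∑ i, ∑ j, c i * c j * (X (t i) ω * X (t j) ω) := by
      intro ω
      rw [pow_two, Finset.sum_mul_sum]
      refine Finset.sum_congr rfl fun i _ => Finset.sum_congr rfl fun j _ => ?_
      ring
    simp only [e]
    rw [integral_finsetSum _ fun i _ => (HasAllMoments.sum _ fun j _ =>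
      ((hm (t i)).mul (hm (t j))).const_mul _).integrable]
    refine Finset.sum_congr rfl fun i _ => ?_
    rw [integral_finsetSum _ fun j _ => (((hm (t i)).mul (hm (t j))).const_mul _).integrable]
    refine Finset.sum_congr rfl fun j _ => ?_
    rw [integral_const_mul, h.cov_eq]
  rw [← key]
  exact integral_nonneg fun ω => sq_nonneg _

theorem posSemidef_toeplitz [IsProbabilityMeasure P] (h : IsStationaryGaussianSeq P X ρ) (n : ℕ) :
    (Matrix.of (toeplitz ρ n)).PosSemidef :=
  Matrix.posSemidef_of_sum_nonneg (h.toeplitz_symm n)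
    fun c => h.sum_mul_mul_nonneg (fun i : Fin n => ((i : ℕ) : ℤ)) c

/-- If the variance vanishes, stationarity makes every window sum of length `n` vanish almost
surely. Subtracting consecutive windows gives `H_q(X_{m+n}) = H_q(X_m)`. Then `ρ(mn)^q = 1` for all
natural `m`, which is impossible when `ρ → 0`. -/
theorem v_pos [IsProbabilityMeasure P] (h : IsStationaryGaussianSeq P X ρ) {q : ℕ} (hq : q ≠ 0)
    (hρ : Tendsto ρ cofinite (𝓝 0)) {n : ℕ} (hn : 1 ≤ n) : 0 < v q P X n := by
  have hG := h.isUnitGaussianFamily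
  have hn' : (n : ℝ) ≠ 0 := by positivity
  have hq! : (q.factorial : ℝ) ≠ 0 := by positivity
  refine lt_of_le_of_ne (integral_nonneg fun ω => sq_nonneg _) fun h0 => ?_
  rw [h.v_eq] at h0
  have hsum : ∑ i, ∑ j, toeplitz ρ n i j ^ q = 0 := by
    rcases mul_eq_zero.1 h0.symm with h1 | h1
    · exact absurd h1 (div_ne_zero hq! hn')
    · exact h1
  have hS : ∀ m : ℤ, ∀ᵐ ω ∂P, ∑ i ∈ Finset.range n, (realHermite q).eval (X (m + i) ω) = 0 := by
    intro m
    have h2 := hG.integral_sum_sq q (fun i : Fin n => m + ((i : ℕ) : ℤ))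
    simp only [add_sub_add_left_eq_sub] at h2
    rw [show ∑ i : Fin n, ∑ j : Fin n, ρ (((i : ℕ) : ℤ) - ((j : ℕ) : ℤ)) ^ q = 0 from hsum,
      mul_zero, integral_eq_zero_iff_of_nonneg (fun ω => sq_nonneg _)
        ((hG.hasAllMoments_sum q _).pow 2).integrable] at h2
    filter_upwards [h2] with ω hω
    rw [Finset.sum_range]
    exact pow_eq_zero_iff two_ne_zero |>.1 hω
  have hper : ∀ m : ℤ, ∀ᵐ ω ∂P,
      (realHermite q).eval (X (m + n) ω) = (realHermite q).eval (X m ω) := by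
    intro m
    filter_upwards [hS m, hS (m + 1)] with ω h1 h2
    have h3 := Finset.sum_range_succ (fun i : ℕ => (realHermite q).eval (X (m + i) ω)) n
    rw [Finset.sum_range_succ', h1] at h3
    have h4 : ∀ i : ℕ, m + ((i + 1 : ℕ) : ℤ) = m + 1 + i := fun i => by push_cast; ring
    simp only [h4, h2, Nat.cast_zero, add_zero, zero_add] at h3
    exact h3.symm
  have hper' : ∀ m : ℕ, ∀ᵐ ω ∂P,
      (realHermite q).eval (X ((m : ℤ) * n) ω) = (realHermite q).eval (X 0 ω) := by
    intro m
    induction m with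
    | zero => simp
    | succ m ih =>
      filter_upwards [ih, hper (m * n)] with ω h1 h2
      rw [← h1, ← h2]
      push_cast
      ring_nf
  have hone : ∀ m : ℕ, ρ ((m : ℤ) * n) ^ q = 1 := by
    intro m
    have h1 := hG.integral_realHermite_two q q ((m : ℤ) * n) 0
    have h2 := hG.integral_realHermite_two q q 0 0
    rw [if_pos rfl] at h1 h2
    have h3 : ∫ ω, (realHermite q).eval (X ((m : ℤ) * n) ω) * (realHermite q).eval (X 0 ω) ∂P =
        ∫ ω, (realHermite q).eval (X 0 ω) * (realHermite q).eval (X 0 ω) ∂P := by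
      refine integral_congr_ae ?_
      filter_upwards [hper' m] with ω hω
      rw [hω]
    rw [h1, h2, sub_zero, sub_zero, h.unit_variance, one_pow] at h3
    exact mul_left_cancel₀ hq! h3
  have hinj : Function.Injective (fun m : ℕ => (m : ℤ) * n) := by
    intro a b hab
    simpa [show n ≠ 0 by omega] using hab
  have hlim := (hρ.comp (hinj.tendsto_cofinite)).pow q
  simp only [Function.comp_def, hone, zero_pow hq] at hlim
  exact one_ne_zero (tendsto_nhds_unique tendsto_const_nhds hlim)

/-- The constant on the left equals `q²`. The variance in the normalisation cancels against the
Cauchy-Schwarz lower bound, so neither `n` nor `ρ` enters. -/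
theorem le_mul_cumulant_F [IsProbabilityMeasure P] (h : IsStationaryGaussianSeq P X ρ) {q : ℕ}
    (hq : 2 ≤ q) {n : ℕ} (hn : 1 ≤ n) (hv : 0 < v q P X n) :
    diagramCoeff q 0 1 (q - 1) / (q.factorial : ℝ) ^ 2 ≤ n * cumulant P (F q P X n) 4 := by
  have hn' : (0 : ℝ) < n := by positivity
  have h1 := le_connectedSum (h.posSemidef_toeplitz n) hq
  have h2 := sq_sum_pow_le_card_mul_quadSum (h.posSemidef_toeplitz n) 1 (q - 1)
  rw [show 1 + (q - 1) = q by omega, Fintype.card_fin] at h2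
  have h3 : ∑ i, ∑ j, Matrix.of (toeplitz ρ n) i j ^ q = v q P X n * n / q.factorial := by
    rw [h.v_eq]; simp only [Matrix.of_apply]; field_simp
  rw [h3] at h2
  rw [h.cumulant_F (by omega) n hv]
  have h4 : diagramCoeff q 0 1 (q - 1) * (v q P X n * n / q.factorial) ^ 2 ≤
      n * connectedSum q (toeplitz ρ n) := by
    calc _ ≤ diagramCoeff q 0 1 (q - 1) *
          (n * quadSum (Matrix.of (toeplitz ρ n)) 0 1 (q - 1)) :=
          mul_le_mul_of_nonneg_left h2 (diagramCoeff_pos _ _ _ _).le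
      _ = n * (diagramCoeff q 0 1 (q - 1) * quadSum (Matrix.of (toeplitz ρ n)) 0 1 (q - 1)) := by
          ring
      _ ≤ _ := mul_le_mul_of_nonneg_left h1 hn'.le
  rw [← mul_div_assoc, le_div_iff₀ (by positivity)]
  refine le_of_eq_of_le ?_ h4
  field_simp

theorem cumulant_F_le [IsProbabilityMeasure P] (h : IsStationaryGaussianSeq P X ρ) {q : ℕ}
    (hq : 1 ≤ q) {n : ℕ} (hv : 0 < v q P X n) {C B : ℝ}
    (hC : connectedSum q (toeplitz ρ n) ≤ C * (n * B)) :
    cumulant P (F q P X n) 4 ≤ C / ((v q P X n) ^ 2 * n) * B := by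
  rw [h.cumulant_F hq n hv]
  rcases Nat.eq_zero_or_pos n with rfl | hn
  · simp
  have hn' : (0 : ℝ) < n := by positivity
  rw [div_le_iff₀ (by positivity)]
  refine hC.trans_eq ?_
  field_simp

theorem exists_cumulant_F_le {q : ℕ} (hq : 2 ≤ q) : ∃ C : ℝ, 0 < C ∧
    ∀ {Ω : Type*} [MeasurableSpace Ω] (P : Measure Ω) [IsProbabilityMeasure P]
      (X : ℤ → Ω → ℝ) (ρ : ℤ → ℝ), IsStationaryGaussianSeq P X ρ → ∀ n, 0 < v q P X n →
      (q ≤ 3 → cumulant P (F q P X n) 4 ≤ C / ((v q P X n) ^ 2 * n) *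
        (∑ k ∈ Finset.Ioo (-(n : ℤ)) (n : ℤ), |ρ k| ^ (2 * (q : ℝ) / 3)) ^ 3) ∧
      (3 ≤ q → cumulant P (F q P X n) 4 ≤ C / ((v q P X n) ^ 2 * n) *
        (∑ k ∈ Finset.Ioo (-(n : ℤ)) (n : ℤ), |ρ k| ^ (q - 1)) ^ 2 *
          (∑ k ∈ Finset.Ioo (-(n : ℤ)) (n : ℤ), |ρ k| ^ 2)) := by
  obtain ⟨C, hC0, hC⟩ := exists_connectedSum_le q
  refine ⟨C, hC0, fun {Ω} _ P _ X ρ h n hv => ?_⟩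
  have hR := hC (toeplitz ρ n) (h.toeplitz_symm n)
  have hbig : cumulant P (F q P X n) 4 ≤ C / ((v q P X n) ^ 2 * n) *
        ((∑ k ∈ Finset.Ioo (-(n : ℤ)) (n : ℤ), |ρ k| ^ (q - 1)) ^ 2 *
          (∑ k ∈ Finset.Ioo (-(n : ℤ)) (n : ℤ), |ρ k| ^ 2)) := by
    refine h.cumulant_F_le (by omega) hv (hR.trans (mul_le_mul_of_nonneg_left ?_ hC0.le))
    have := quadSum_abs_le (h.toeplitz_symm n) (q - 1)
      (sum_toeplitz_row_le ρ (g := fun x => |x| ^ (q - 1)) (fun _ => by positivity) n)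
      (sum_toeplitz_row_le ρ (g := fun x => |x| ^ 2) (fun _ => by positivity) n)
      (by positivity) (by positivity)
    simpa using this
  refine ⟨fun hq3 => ?_, fun _ => by rw [mul_assoc]; exact hbig⟩
  obtain rfl | rfl : q = 2 ∨ q = 3 := by omega
  · refine h.cumulant_F_le (by omega) hv (hR.trans (mul_le_mul_of_nonneg_left ?_ hC0.le))
    have := quadSum_abs_one_one_le (h.toeplitz_symm n)
      (sum_toeplitz_row_le ρ (g := fun x => |x| ^ (4 / 3 : ℝ)) (fun _ => by positivity) n)
      (by positivity)
    norm_num at this ⊢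
    exact this
  -- At `q = 3` the exponents `2q/3` and `q - 1` are both `2`, so the two bounds coincide.
  · refine hbig.trans_eq ?_
    have e : 2 * ((3 : ℕ) : ℝ) / 3 = (2 : ℕ) := by norm_num
    rw [e]
    simp only [Real.rpow_natCast, Nat.reduceSub]
    ring

end IsStationaryGaussianSeq

end BreuerMajor

end

/-! ### Averages of sums over growing windows. -/

section Window

variable {α : Type*} {κ : ℕ → Type*} (φ : ∀ n, Fin n → κ n → α)

/-- The number of `i < n` for which `p` is one of the points `φ n i x`. -/
noncomputable def windowCount (n : ℕ) (p : α) : ℝ :=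
  ∑ i : Fin n, (Set.range (φ n i)).indicator 1 p

theorem windowCount_nonneg (n : ℕ) (p : α) : 0 ≤ windowCount φ n p :=
  Finset.sum_nonneg fun _ _ => Set.indicator_nonneg (fun _ _ => zero_le_one) _

theorem windowCount_le (n : ℕ) (p : α) : windowCount φ n p ≤ n := by
  calc windowCount φ n p ≤ ∑ _i : Fin n, (1 : ℝ) :=
        Finset.sum_le_sum fun _ _ => Set.indicator_le_self' (fun _ _ => zero_le_one) _
    _ = n := by simp

theorem windowCount_div_le_one (n : ℕ) (p : α) : windowCount φ n p / n ≤ 1 :=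
  div_le_one_of_le₀ (windowCount_le φ n p) (by positivity)

variable {φ}

theorem hasSum_windowCount_mul [∀ n, Fintype (κ n)]
    (hφ : ∀ n i, Function.Injective (φ n i)) (g : α → ℝ) (n : ℕ) :
    HasSum (fun p => windowCount φ n p * g p) (∑ i, ∑ x, g (φ n i x)) := by
  have h : ∀ i : Fin n, HasSum ((Set.range (φ n i)).indicator g) (∑ x, g (φ n i x)) := by
    intro i
    rw [← (hφ n i).hasSum_iff (fun x hx => Set.indicator_of_notMem hx g)]
    have : (Set.range (φ n i)).indicator g ∘ φ n i = fun x => g (φ n i x) := by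
      ext x; simp
    rw [this]
    exact hasSum_fintype _
  have e : (fun p => windowCount φ n p * g p) =
      fun p => ∑ i, (Set.range (φ n i)).indicator g p := by
    ext p
    rw [windowCount, Finset.sum_mul]
    refine Finset.sum_congr rfl fun i _ => ?_
    by_cases hp : p ∈ Set.range (φ n i)
    · rw [Set.indicator_of_mem hp, Set.indicator_of_mem hp, Pi.one_apply, one_mul]
    · rw [Set.indicator_of_notMem hp, Set.indicator_of_notMem hp, zero_mul]
  rw [e]
  exact hasSum_sum fun i _ => h i

/-- Only base points within `M` of an end of `{0, …, n-1}` can miss `p`, so the count is at least `n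
- 2M`. -/
theorem tendsto_windowCount_div
    (hw : ∀ p, ∃ M : ℕ, ∀ n (i : Fin n), M ≤ (i : ℕ) → (i : ℕ) + M < n → p ∈ Set.range (φ n i))
    (p : α) : Tendsto (fun n : ℕ => windowCount φ n p / n) atTop (𝓝 1) := by
  obtain ⟨M, hM⟩ := hw p
  have hlow : ∀ n : ℕ, (n : ℝ) - 2 * M ≤ windowCount φ n p := by
    intro n
    have h1 : ∀ i : Fin n, (if (i : ℕ) ∈ Finset.Ico M (n - M) then (1 : ℝ) else 0) ≤
        (Set.range (φ n i)).indicator 1 p := by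
      intro i
      split_ifs with h
      · rw [Finset.mem_Ico] at h
        rw [Set.indicator_of_mem (hM n i h.1 (by omega))]
        rfl
      · exact Set.indicator_nonneg (fun _ _ => zero_le_one) _
    refine le_trans ?_ (Finset.sum_le_sum fun i _ => h1 i)
    rw [← Finset.sum_range (fun i : ℕ => if i ∈ Finset.Ico M (n - M) then (1 : ℝ) else 0),
      ← Finset.sum_filter, Finset.sum_const, nsmul_eq_mul, mul_one]
    have : Finset.filter (fun i => i ∈ Finset.Ico M (n - M)) (Finset.range n) =
        Finset.Ico M (n - M) := by
      ext i; simp; omega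
    rw [this, Nat.card_Ico, sub_le_iff_le_add]
    exact_mod_cast (by omega : n ≤ n - M - M + 2 * M)
  have hlim : Tendsto (fun n : ℕ => ((n : ℝ) - 2 * M) / n) atTop (𝓝 1) := by
    have : Tendsto (fun n : ℕ => 1 - (2 * M : ℝ) / n) atTop (𝓝 (1 - 0)) :=
      tendsto_const_nhds.sub (tendsto_const_div_atTop_nhds_zero_nat _)
    rw [sub_zero] at this
    refine this.congr' ?_
    filter_upwards [eventually_ge_atTop 1] with n hn
    have : (n : ℝ) ≠ 0 := by positivity
    field_simp
  refine tendsto_of_tendsto_of_tendsto_of_le_of_le hlim tendsto_const_nhds (fun n => ?_)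
    (fun n => windowCount_div_le_one φ n p)
  exact div_le_div_of_nonneg_right (hlow n) (by positivity)

/-- Grouping by the value `p` turns the average into `∑ p, (windowCount φ n p / n) * g p`. The
weights lie in `[0, 1]` and tend to `1`, so dominated convergence applies. -/
theorem tendsto_window_sum_div [∀ n, Fintype (κ n)] (hφ : ∀ n i, Function.Injective (φ n i))
    (hw : ∀ p, ∃ M : ℕ, ∀ n (i : Fin n), M ≤ (i : ℕ) → (i : ℕ) + M < n → p ∈ Set.range (φ n i))
    {g : α → ℝ} (hg : Summable g) :
    Tendsto (fun n : ℕ => (∑ i, ∑ x, g (φ n i x)) / n) atTop (𝓝 (∑' p, g p)) := by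
  have h1 : ∀ n : ℕ, (∑ i, ∑ x, g (φ n i x)) / n = ∑' p, windowCount φ n p / n * g p := by
    intro n
    rw [← (hasSum_windowCount_mul hφ g n).tsum_eq, ← tsum_div_const]
    exact tsum_congr fun p => by ring
  simp only [h1]
  refine tendsto_tsum_of_dominated_convergence hg.norm (fun p => ?_) (.of_forall fun n p => ?_)
  · simpa using (tendsto_windowCount_div hw p).mul_const (g p)
  · rw [norm_mul, Real.norm_of_nonneg (div_nonneg (windowCount_nonneg φ n p) (by positivity))]
    exact mul_le_of_le_one_left (norm_nonneg _) (windowCount_div_le_one φ n p)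

/-- A bound on the averages that is uniform in `n` passes to every finite partial sum of `g`. It
converts the finite matrix inequalities into summability over the lattice. -/
theorem summable_of_window_sum_le [∀ n, Fintype (κ n)] (hφ : ∀ n i, Function.Injective (φ n i))
    (hw : ∀ p, ∃ M : ℕ, ∀ n (i : Fin n), M ≤ (i : ℕ) → (i : ℕ) + M < n → p ∈ Set.range (φ n i))
    {g : α → ℝ} (hg : ∀ p, 0 ≤ g p) {A : ℝ} (hA : ∀ n : ℕ, ∑ i, ∑ x, g (φ n i x) ≤ n * A) :
    Summable g := by
  have hA0 : 0 ≤ A := by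
    have := (Finset.sum_nonneg fun i _ => Finset.sum_nonneg fun x _ => hg (φ 1 i x)).trans (hA 1)
    simpa using this
  refine summable_of_sum_le hg (c := A) fun s => ?_
  have hlim : Tendsto (fun n : ℕ => ∑ p ∈ s, windowCount φ n p / n * g p) atTop
      (𝓝 (∑ p ∈ s, 1 * g p)) :=
    tendsto_finsetSum _ fun p _ => (tendsto_windowCount_div hw p).mul_const _
  simp only [one_mul] at hlim
  refine le_of_tendsto' hlim fun n => ?_
  have h1 := hasSum_windowCount_mul hφ g n
  have h2 := h1.summable.sum_le_tsum s fun p _ => mul_nonneg (windowCount_nonneg φ n p) (hg p)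
  rw [h1.tsum_eq] at h2
  have h3 : ∑ p ∈ s, windowCount φ n p / n * g p = (∑ p ∈ s, windowCount φ n p * g p) / n := by
    rw [Finset.sum_div]; exact Finset.sum_congr rfl fun p _ => by ring
  rw [h3]
  exact div_le_of_le_mul₀ (by positivity) hA0 (h2.trans ((hA n).trans_eq (mul_comm _ _)))

end Window

/-! ### The limit for `q = 2` as a sum over 4-cycles. -/

namespace BreuerMajor

/-- The differences `i - j` for `i, j < n`. -/
def difference (n : ℕ) (i j : Fin n) : ℤ := ((i : ℕ) : ℤ) - ((j : ℕ) : ℤ)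

/-- The triples of differences `(i - j, i - k, j - l)` for `i, j, k, l < n`. -/
def differenceTriple (n : ℕ) (i : Fin n) (x : Fin n × Fin n × Fin n) : ℤ × ℤ × ℤ :=
  (difference n i x.1, difference n i x.2.1, difference n x.1 x.2.2)

theorem difference_injective (n : ℕ) (i : Fin n) : Function.Injective (difference n i) := by
  intro a b h
  simp only [difference, sub_right_inj, Nat.cast_inj] at h
  exact Fin.ext h

theorem differenceTriple_injective (n : ℕ) (i : Fin n) :
    Function.Injective (differenceTriple n i) := by
  rintro ⟨a, b, c⟩ ⟨a', b', c'⟩ h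
  simp only [differenceTriple, Prod.mk.injEq] at h
  obtain ⟨h1, h2, h3⟩ := h
  obtain rfl := difference_injective n i h1
  obtain rfl := difference_injective n i h2
  obtain rfl := difference_injective n a h3
  rfl

theorem exists_mem_range_difference (p : ℤ) : ∃ M : ℕ, ∀ n (i : Fin n), M ≤ (i : ℕ) →
    (i : ℕ) + M < n → p ∈ Set.range (difference n i) := by
  refine ⟨p.natAbs, fun n i h1 h2 => ⟨⟨((i : ℤ) - p).toNat, by omega⟩, ?_⟩⟩
  simp only [difference]
  omega

theorem exists_mem_range_differenceTriple (p : ℤ × ℤ × ℤ) : ∃ M : ℕ, ∀ n (i : Fin n),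
    M ≤ (i : ℕ) → (i : ℕ) + M < n → p ∈ Set.range (differenceTriple n i) := by
  obtain ⟨a, b, c⟩ := p
  refine ⟨a.natAbs + b.natAbs + c.natAbs, fun n i h1 h2 =>
    ⟨(⟨((i : ℤ) - a).toNat, by omega⟩, ⟨((i : ℤ) - b).toNat, by omega⟩,
      ⟨((i : ℤ) - a - c).toNat, by omega⟩), ?_⟩⟩
  simp only [differenceTriple, difference, Prod.mk.injEq]
  omega

/-- The summand of the limit of `n⁻¹ tr(R_n⁴)`. -/
def cycleTerm (ρ : ℤ → ℝ) (p : ℤ × ℤ × ℤ) : ℝ :=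
  ρ p.1 * ρ p.2.1 * (ρ p.2.2 * ρ (p.1 + p.2.2 - p.2.1))

theorem quadSum_toeplitz (ρ : ℤ → ℝ) (n : ℕ) : quadSum (toeplitz ρ n) 1 1 0 =
    ∑ i, ∑ x, cycleTerm ρ (differenceTriple n i x) := by
  simp only [quadSum, Fintype.sum_prod_type, cycleTerm, differenceTriple, difference, toeplitz,
    pow_one, pow_zero, mul_one]
  refine Finset.sum_congr rfl fun i _ => Finset.sum_congr rfl fun j _ =>
    Finset.sum_congr rfl fun k _ => Finset.sum_congr rfl fun l _ => ?_
  rw [show ((i : ℕ) : ℤ) - (j : ℕ) + ((j : ℕ) - (l : ℕ)) - ((i : ℕ) - (k : ℕ)) =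
    ((k : ℕ) : ℤ) - (l : ℕ) by ring]
  ring

theorem cycleTerm_abs (ρ : ℤ → ℝ) (p : ℤ × ℤ × ℤ) :
    cycleTerm (fun k => |ρ k|) p = |cycleTerm ρ p| := by
  simp only [cycleTerm, abs_mul]

theorem summable_abs_cycleTerm {ρ : ℤ → ℝ} (hs : ∀ k, ρ (-k) = ρ k)
    (hρ : Summable fun k => |ρ k| ^ (4 / 3 : ℝ)) : Summable (fun p => |cycleTerm ρ p|) := by
  simp only [← cycleTerm_abs]
  refine summable_of_window_sum_le differenceTriple_injective exists_mem_range_differenceTriple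
    (fun p => by rw [cycleTerm_abs]; exact abs_nonneg _)
    (A := (∑' k, |ρ k| ^ (4 / 3 : ℝ)) ^ 3) fun n => ?_
  rw [← quadSum_toeplitz]
  have := quadSum_abs_one_one_le (R := toeplitz ρ n)
    (fun i j => by rw [toeplitz, toeplitz, ← hs, neg_sub])
    (fun i => (sum_toeplitz_row_le ρ (g := fun x => |x| ^ (4 / 3 : ℝ))
      (fun _ => by positivity) n i).trans (hρ.sum_le_tsum _ fun _ _ => by positivity))
    (tsum_nonneg fun _ => by positivity)
  rw [Fintype.card_fin] at this
  exact this

/-- The connected diagrams have exponents `(1,1,0)`, `(1,0,1)`, `(0,1,1)`. Each has coefficient `2!⁴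
= 16`, and symmetry makes the three sums equal. -/
theorem connectedSum_two {ι : Type*} [Fintype ι] {R : ι → ι → ℝ} (hs : ∀ i j, R i j = R j i) :
    connectedSum 2 R = 48 * quadSum R 1 1 0 := by
  have e1 := quadSum_comm₂₃ hs 1 0 1
  have e2 := quadSum_comm₁₂ hs 0 1 1
  have a2 : Finset.HasAntidiagonal.antidiagonal 2 = {((0, 2) : ℕ × ℕ), (1, 1), (2, 0)} := rfl
  have a1 : Finset.HasAntidiagonal.antidiagonal 1 = {((0, 1) : ℕ × ℕ), (1, 0)} := rfl
  have a0 : Finset.HasAntidiagonal.antidiagonal 0 = {((0, 0) : ℕ × ℕ)} := rfl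
  simp [connectedSum, a2, a1, a0, diagramCoeff, e2, e1]
  norm_num
  ring

variable {Ω : Type*} [MeasurableSpace Ω] {P : Measure Ω} [IsProbabilityMeasure P]
  {X : ℤ → Ω → ℝ} {ρ : ℤ → ℝ}

theorem IsStationaryGaussianSeq.tendsto_mul_cumulant_F_two (h : IsStationaryGaussianSeq P X ρ)
    (hρ : Summable fun k => |ρ k| ^ (4 / 3 : ℝ)) (hρ2 : Summable fun k => ρ k ^ 2)
    (hv : ∀ n, 1 ≤ n → 0 < v 2 P X n) (hpos : 0 < ∑' k, ρ k ^ 2) :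
    Tendsto (fun n : ℕ => (n : ℝ) * cumulant P (F 2 P X n) 4) atTop
      (𝓝 (12 * (∑' p, cycleTerm ρ p) / (∑' k, ρ k ^ 2) ^ 2)) := by
  have h1 : Tendsto (fun n : ℕ => quadSum (toeplitz ρ n) 1 1 0 / n) atTop
      (𝓝 (∑' p, cycleTerm ρ p)) := by
    simp only [quadSum_toeplitz]
    exact tendsto_window_sum_div differenceTriple_injective exists_mem_range_differenceTriple
      (summable_abs_cycleTerm h.neg hρ).of_abs
  have h2 : Tendsto (fun n : ℕ => v 2 P X n) atTop (𝓝 (2 * ∑' k, ρ k ^ 2)) := by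
    have := (tendsto_window_sum_div difference_injective exists_mem_range_difference
      hρ2).const_mul 2
    refine this.congr fun n => ?_
    rw [h.v_eq]
    simp only [difference, toeplitz, Nat.factorial_two]
    push_cast
    ring
  have h3 := (h1.const_mul 48).div (h2.pow 2) (by positivity)
  have h4 : 48 * (∑' p, cycleTerm ρ p) / (2 * ∑' k, ρ k ^ 2) ^ 2 =
      12 * (∑' p, cycleTerm ρ p) / (∑' k, ρ k ^ 2) ^ 2 := by
    field_simp; ring
  rw [h4] at h3
  refine h3.congr' ?_
  filter_upwards [eventually_ge_atTop 1] with n hn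
  have hn' : (n : ℝ) ≠ 0 := by positivity
  have := (hv n hn).ne'
  rw [h.cumulant_F (by norm_num) n (hv n hn), connectedSum_two (h.toeplitz_symm n)]
  simp only [Pi.div_apply]
  field_simp

end BreuerMajor

/-! ### Fourier coefficients of products and sums of squared convolutions. -/

section FourierProduct

open AddCircle
open scoped ComplexConjugate InnerProductSpace

variable {T : ℝ} [hT : Fact (0 < T)]

theorem fourierBasis_repr_toLp {f : AddCircle T → ℂ}
    (hf : MemLp f 2 AddCircle.haarAddCircle) (i : ℤ) :
    fourierBasis.repr hf.toLp i = fourierCoeff f i := by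
  rw [fourierBasis_repr, fourierCoeff_congr_ae hf.coeFn_toLp]

theorem MeasureTheory.MemLp.hasSum_sq_fourierCoeff {f : AddCircle T → ℂ}
    (hf : MemLp f 2 AddCircle.haarAddCircle) :
    HasSum (fun i => ‖fourierCoeff f i‖ ^ 2) (∫ t, ‖f t‖ ^ 2 ∂AddCircle.haarAddCircle) := by
  have h := _root_.hasSum_sq_fourierCoeff hf.toLp
  rw [fourierCoeff_congr_ae hf.coeFn_toLp] at h
  convert h using 1
  refine integral_congr_ae ?_
  filter_upwards [hf.coeFn_toLp] with t ht
  rw [ht]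

/-- The Fourier coefficients of a product of two `L²` functions are the convolution of their
Fourier coefficients. -/
theorem hasSum_fourierCoeff_mul {u w : AddCircle T → ℂ} (hu : MemLp u 2 AddCircle.haarAddCircle)
    (hw : MemLp w 2 AddCircle.haarAddCircle) (k : ℤ) :
    HasSum (fun m => fourierCoeff u m * fourierCoeff w (k - m))
      (fourierCoeff (fun t => u t * w t) k) := by
  -- The `k`-th coefficient of `u w` is the inner product of `u` with `e_k` times the conjugate of
  -- `w`. Parseval for this inner product is the convolution formula.
  have hz : MemLp (fun t => fourier k t * conj (w t)) 2 AddCircle.haarAddCircle := by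
    refine hw.of_le ?_ (ae_of_all _ fun t => ?_)
    · exact (map_continuous (fourier k)).aestronglyMeasurable.mul
        (Complex.continuous_conj.comp_aestronglyMeasurable hw.1)
    · rw [norm_mul, RCLike.norm_conj, fourier_apply, Circle.norm_coe, one_mul]
  have h := fourierBasis.hasSum_inner_mul_inner hz.toLp hu.toLp
  have h1 : ∀ m, ⟪hz.toLp, fourierBasis m⟫_ℂ = fourierCoeff w (k - m) := by
    intro m
    rw [← inner_conj_symm, ← HilbertBasis.repr_apply_apply, fourierBasis_repr_toLp, fourierCoeff,
      fourierCoeff, ← integral_conj]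
    refine integral_congr_ae (ae_of_all _ fun t => ?_)
    simp only [smul_eq_mul, map_mul, Complex.conj_conj]
    rw [← fourier_neg, ← fourier_neg, neg_neg, ← mul_assoc, ← fourier_add]
    congr 3
    ring
  have h2 : ∀ m, ⟪fourierBasis m, hu.toLp⟫_ℂ = fourierCoeff u m := by
    intro m
    rw [← HilbertBasis.repr_apply_apply, fourierBasis_repr_toLp]
  have h3 : ⟪hz.toLp, hu.toLp⟫_ℂ = fourierCoeff (fun t => u t * w t) k := by
    rw [L2.inner_def, fourierCoeff]
    refine integral_congr_ae ?_
    filter_upwards [hz.coeFn_toLp, hu.coeFn_toLp] with t ht1 ht2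
    rw [ht1, ht2, RCLike.inner_apply', map_mul, Complex.conj_conj, ← fourier_neg, smul_eq_mul]
    ring
  simp only [h1, h2, h3] at h
  simpa only [mul_comm] using h

/-- Parseval for `u²`, whose coefficients are the self-convolution of those of `u`. -/
theorem hasSum_sq_norm_tsum_fourierCoeff {u : AddCircle T → ℂ}
    (hu : MemLp u 2 AddCircle.haarAddCircle)
    (hu2 : MemLp (fun t => u t ^ 2) 2 AddCircle.haarAddCircle) :
    HasSum (fun k => ‖∑' m, fourierCoeff u m * fourierCoeff u (k - m)‖ ^ 2)
      (∫ t, ‖u t‖ ^ 4 ∂AddCircle.haarAddCircle) := by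
  have h := hu2.hasSum_sq_fourierCoeff
  convert h using 2
  · congr 2
    rw [(hasSum_fourierCoeff_mul hu hu _).tsum_eq]
    simp only [sq]
  · ext t
    rw [norm_pow]
    ring

end FourierProduct

namespace BreuerMajor

theorem summable_mul_sub {ρ : ℤ → ℝ} (hρ : Summable fun k => ρ k ^ 2) (k : ℤ) :
    Summable fun m => ρ m * ρ (k - m) := by
  have h2 : Summable fun m => ρ (k - m) ^ 2 :=
    (Equiv.subLeft k).summable_iff.mpr hρ
  refine Summable.of_norm_bounded (hρ.add h2) fun m => ?_
  rw [Real.norm_eq_abs, abs_le]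
  constructor <;> nlinarith [sq_nonneg (ρ m + ρ (k - m)), sq_nonneg (ρ m - ρ (k - m)),
    sq_nonneg (ρ m), sq_nonneg (ρ (k - m))]

/-- The sum of the squares of the self-convolution of `ρ`, as a sum over `4`-cycles. -/
theorem hasSum_sq_tsum_mul_sub {ρ : ℤ → ℝ} (hρ : Summable fun k => ρ k ^ 2)
    (hc : Summable fun p => |cycleTerm ρ p|) :
    HasSum (fun k => (∑' m, ρ m * ρ (k - m)) ^ 2) (∑' p, cycleTerm ρ p) := by
  -- Chosen so that the cycle term at `e (k, m, m')` is the `(m, m')` term of the squared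
  -- convolution at `k`.
  let e : ℤ × ℤ × ℤ ≃ ℤ × ℤ × ℤ :=
    { toFun := fun p => (p.2.1, p.2.2, p.1 - p.2.1)
      invFun := fun p => (p.1 + p.2.2, p.1, p.2.1)
      left_inv := fun p => by ext <;> simp
      right_inv := fun p => by ext <;> simp }
  have h1 : HasSum (fun p => cycleTerm ρ (e p)) (∑' p, cycleTerm ρ p) :=
    e.hasSum_iff.mpr hc.of_abs.hasSum
  have e1 : ∀ k m m', cycleTerm ρ (e (k, m, m')) = (ρ m * ρ (k - m)) * (ρ m' * ρ (k - m')) := by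
    intro k m m'
    simp only [cycleTerm, e, Equiv.coe_fn_mk]
    rw [show m + (k - m) - m' = k - m' by ring]
    ring
  refine h1.prod_fiberwise fun k => ?_
  have hk := summable_mul_sub hρ k
  have h2 : Summable fun x : ℤ × ℤ => (ρ x.1 * ρ (k - x.1)) * (ρ x.2 * ρ (k - x.2)) := by
    have := h1.summable.prod_factor k
    simpa only [e1] using this
  have := hk.hasSum.mul hk.hasSum h2
  rw [← sq] at this
  simpa only [e1] using this

end BreuerMajor

/-! ### The spectral density and its Fejér means. -/

namespace BreuerMajor

section SpectralDensity

variable {ρ : ℤ → ℝ}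

theorem exists_hasSum_spectralTerm (hρ : Summable fun k => ρ k ^ 2) :
    ∃ f : Lp ℂ 2 (AddCircle.haarAddCircle (T := 2 * Real.pi)), HasSum (spectralTerm ρ) f ∧
      ∀ k, fourierCoeff f k = ρ k := by
  have hmem : Memℓp (fun k => (ρ k : ℂ)) 2 := by
    rw [memℓp_gen_iff (by norm_num)]
    simpa using hρ
  let x : lp (fun _ : ℤ => ℂ) 2 := ⟨_, hmem⟩
  refine ⟨fourierBasis.repr.symm x, ?_, fun k => ?_⟩
  · have := (fourierBasis (T := 2 * Real.pi)).hasSum_repr_symm x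
    rw [coe_fourierBasis] at this
    exact this
  · rw [← fourierBasis_repr, LinearIsometryEquiv.apply_symm_apply]

theorem summable_spectralTerm (hρ : Summable fun k => ρ k ^ 2) : Summable (spectralTerm ρ) :=
  let ⟨_, h, _⟩ := exists_hasSum_spectralTerm hρ
  h.summable

theorem fourierCoeff_g₁ (hρ : Summable fun k => ρ k ^ 2) (k : ℤ) :
    fourierCoeff (g₁ ρ) k = ρ k := by
  obtain ⟨f, h, hf⟩ := exists_hasSum_spectralTerm hρ
  rw [g₁, h.tsum_eq, hf]

variable (ρ) in
/-- The arithmetic means of the partial sums of `∑ k, ρ k * exp (i k t)`. -/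
noncomputable def fejerMean (n : ℕ) (t : Torus) : ℂ :=
  (n : ℂ)⁻¹ * ∑ i : Fin n, ∑ j : Fin n, (ρ (difference n i j) : ℂ) * fourier (difference n i j) t

theorem continuous_fejerMean (n : ℕ) : Continuous (fejerMean ρ n) := by
  unfold fejerMean
  refine continuous_const.mul (continuous_finsetSum _ fun i _ => continuous_finsetSum _ fun j _ =>
    continuous_const.mul (map_continuous _))

theorem memLp_fejerMean (n : ℕ) (p : ℝ≥0∞) :
    MemLp (fejerMean ρ n) p AddCircle.haarAddCircle :=
  (continuous_fejerMean n).memLp_of_hasCompactSupport (HasCompactSupport.of_compactSpace _)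

/-- For `n ≥ 1` the factor `windowCount difference n k / n` is the Fejér weight `max (1 - |k|/n) 0`,
so the window lemmas apply to it. -/
theorem fourierCoeff_fejerMean (n : ℕ) (k : ℤ) :
    fourierCoeff (fejerMean ρ n) k = ((windowCount difference n k / n * ρ k : ℝ) : ℂ) := by
  have hsum : ∑ i, ∑ j, (if difference n i j = k then ρ k else 0) =
      windowCount difference n k * ρ k := by
    refine (hasSum_windowCount_mul difference_injective
      (fun p => if p = k then ρ k else 0) n).unique ?_
    convert hasSum_ite_eq k (windowCount difference n k * ρ k) using 2 with p
    split_ifs with hp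
    · rw [hp]
    · rw [mul_zero]
  have hint : ∀ i j : Fin n, Integrable (fun t : Torus => (ρ (difference n i j) : ℂ) *
      fourier (difference n i j) t) AddCircle.haarAddCircle := fun i j =>
    (continuous_const.mul (map_continuous _)).integrable_of_hasCompactSupport
      (HasCompactSupport.of_compactSpace _)
  have e : fejerMean ρ n = fun t => (n : ℂ)⁻¹ * (∑ i : Fin n, ∑ j : Fin n,
      fun t : Torus => (ρ (difference n i j) : ℂ) * fourier (difference n i j) t) t := by
    ext t
    simp only [fejerMean, Finset.sum_apply]
  rw [e, fourierCoeff.const_mul, fourierCoeff.sum _ _ fun i _ => integrable_finsetSum' _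
    fun j _ => hint i j, Finset.sum_apply]
  have : ∀ i : Fin n, fourierCoeff (∑ j : Fin n, fun t : Torus =>
      (ρ (difference n i j) : ℂ) * fourier (difference n i j) t) k =
      ∑ j, (((if difference n i j = k then ρ k else 0 : ℝ)) : ℂ) := by
    intro i
    rw [fourierCoeff.sum _ _ fun j _ => hint i j, Finset.sum_apply]
    refine Finset.sum_congr rfl fun j _ => ?_
    rw [fourierCoeff.const_mul, fourierCoeff_fourier]
    split_ifs with h
    · rw [h, Pi.single_eq_same, mul_one]
    · rw [Pi.single_eq_of_ne (Ne.symm h), mul_zero, Complex.ofReal_zero]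
  simp only [this]
  norm_cast
  rw [hsum]
  push_cast
  ring

theorem norm_fourierCoeff_fejerMean_le (n : ℕ) (k : ℤ) :
    ‖fourierCoeff (fejerMean ρ n) k‖ ≤ |ρ k| := by
  rw [fourierCoeff_fejerMean, Complex.norm_real, Real.norm_eq_abs, abs_mul, abs_of_nonneg
    (div_nonneg (windowCount_nonneg _ _ _) (Nat.cast_nonneg n))]
  exact mul_le_of_le_one_left (abs_nonneg _) (windowCount_div_le_one _ _ _)

/-- The Fejér means of the Fourier series converge in `L²`. -/
theorem tendsto_eLpNorm_fejerMean_sub (hρ : Summable fun k => ρ k ^ 2) :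
    Tendsto (fun n => eLpNorm (fejerMean ρ n - ⇑(g₁ ρ)) 2 AddCircle.haarAddCircle) atTop (𝓝 0) := by
  have hg : MemLp (g₁ ρ) 2 AddCircle.haarAddCircle := Lp.memLp _
  have hm : ∀ n, MemLp (fejerMean ρ n - ⇑(g₁ ρ)) 2 AddCircle.haarAddCircle :=
    fun n => (memLp_fejerMean n 2).sub hg
  have hc : ∀ n k, ‖fourierCoeff (fejerMean ρ n - ⇑(g₁ ρ)) k‖ ^ 2 =
      (windowCount difference n k / n - 1) ^ 2 * ρ k ^ 2 := by
    intro n k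
    have : fourierCoeff (fejerMean ρ n - ⇑(g₁ ρ)) k =
        (((windowCount difference n k / n - 1) * ρ k : ℝ) : ℂ) := by
      rw [sub_eq_add_neg, fourierCoeff.add ((memLp_fejerMean n 1).integrable le_rfl)
        (hg.integrable one_le_two).neg, Pi.add_apply, fourierCoeff_fejerMean,
        ← neg_one_smul ℂ (⇑(g₁ ρ)), fourierCoeff.const_smul, fourierCoeff_g₁ hρ]
      push_cast
      rw [smul_eq_mul]
      ring
    rw [this, Complex.norm_real, Real.norm_eq_abs, sq_abs, mul_pow]
  have hs : ∀ n, ∑' k, (windowCount difference n k / n - 1) ^ 2 * ρ k ^ 2 =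
      ∫ t, ‖(fejerMean ρ n - ⇑(g₁ ρ)) t‖ ^ 2 ∂AddCircle.haarAddCircle := by
    intro n
    have := (hm n).hasSum_sq_fourierCoeff.tsum_eq
    simpa only [hc] using this
  have hlim : Tendsto (fun n : ℕ => ∑' k, (windowCount difference n k / n - 1) ^ 2 * ρ k ^ 2)
      atTop (𝓝 0) := by
    have := tendsto_tsum_of_dominated_convergence (𝓕 := atTop)
      (f := fun n k => (windowCount difference n k / n - 1) ^ 2 * ρ k ^ 2)
      (g := fun _ => (0 : ℝ)) hρ (fun k => ?_) (Eventually.of_forall fun n k => ?_)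
    · simpa using this
    · have := (((tendsto_windowCount_div exists_mem_range_difference k).sub_const 1).pow
        2).mul_const (ρ k ^ 2)
      simpa using this
    · have h0 : 0 ≤ windowCount difference n k / n :=
        div_nonneg (windowCount_nonneg _ _ _) (Nat.cast_nonneg n)
      have h1 := windowCount_div_le_one difference n k
      rw [Real.norm_of_nonneg (by positivity)]
      exact mul_le_of_le_one_left (sq_nonneg _) (by nlinarith)
  have hE : ∀ n, eLpNorm (fejerMean ρ n - ⇑(g₁ ρ)) 2 AddCircle.haarAddCircle =
      ENNReal.ofReal (√(∑' k, (windowCount difference n k / n - 1) ^ 2 * ρ k ^ 2)) := by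
    intro n
    rw [(hm n).eLpNorm_eq_integral_rpow_norm (by norm_num) (by norm_num), hs, Real.sqrt_eq_rpow]
    norm_num
  simp only [hE]
  have := (ENNReal.continuous_ofReal.comp Real.continuous_sqrt).tendsto 0 |>.comp hlim
  simpa [Function.comp_def] using this

/-- Since `e_{i-j} = e_i * conj e_j`, the Fejér mean is `1/n` times the Hermitian form of the
covariance matrix at the vector `(e_i(t))`. It splits into the real quadratic forms of the real and
imaginary parts. -/
theorem IsStationaryGaussianSeq.fejerMean_im_re {Ω : Type*} [MeasurableSpace Ω] {P : Measure Ω}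
    [IsProbabilityMeasure P] {X : ℤ → Ω → ℝ} (h : IsStationaryGaussianSeq P X ρ) (n : ℕ)
    (t : Torus) : (fejerMean ρ n t).im = 0 ∧ 0 ≤ (fejerMean ρ n t).re := by
  have hf : ∀ i j : Fin n, fourier (difference n i j) t =
      fourier ((i : ℕ) : ℤ) t * (starRingEnd ℂ) (fourier ((j : ℕ) : ℤ) t) := by
    intro i j
    rw [difference, sub_eq_add_neg, fourier_add, fourier_neg]
  have hn : ((n : ℂ)⁻¹) = ((n : ℝ)⁻¹ : ℝ) := by push_cast; rfl
  set a : Fin n → ℝ := fun i => (fourier ((i : ℕ) : ℤ) t).re with ha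
  set b : Fin n → ℝ := fun i => (fourier ((i : ℕ) : ℤ) t).im with hb
  constructor
  · rw [fejerMean, hn, Complex.im_ofReal_mul]
    refine mul_eq_zero_of_right _ ?_
    have h1 : ∑ i, ∑ j, ρ (difference n i j) * (b i * a j) =
        ∑ i, ∑ j, ρ (difference n i j) * (a i * b j) := by
      rw [Finset.sum_comm]
      refine Finset.sum_congr rfl fun i _ => Finset.sum_congr rfl fun j _ => ?_
      rw [← h.neg, difference, difference, neg_sub, mul_comm (b j)]
    calc _ = ∑ i, ∑ j,
          (ρ (difference n i j) * (b i * a j) - ρ (difference n i j) * (a i * b j)) := by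
          rw [Complex.im_sum]
          refine Finset.sum_congr rfl fun i _ => ?_
          rw [Complex.im_sum]
          refine Finset.sum_congr rfl fun j _ => ?_
          rw [Complex.im_ofReal_mul, hf, Complex.mul_im, Complex.conj_re, Complex.conj_im]
          ring
      _ = 0 := by simp only [Finset.sum_sub_distrib, h1, sub_self]
  · rw [fejerMean, hn, Complex.re_ofReal_mul]
    refine mul_nonneg (by positivity) ?_
    have e : (∑ i : Fin n, ∑ j : Fin n, (ρ (difference n i j) : ℂ) *
        fourier (difference n i j) t).re = (∑ i, ∑ j, a i * a j * ρ (difference n i j)) +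
          ∑ i, ∑ j, b i * b j * ρ (difference n i j) := by
      simp only [← Finset.sum_add_distrib]
      rw [Complex.re_sum]
      refine Finset.sum_congr rfl fun i _ => ?_
      rw [Complex.re_sum]
      refine Finset.sum_congr rfl fun j _ => ?_
      rw [Complex.re_ofReal_mul, hf, Complex.mul_re, Complex.conj_re, Complex.conj_im]
      ring
    rw [e]
    exact add_nonneg (h.sum_mul_mul_nonneg (fun i : Fin n => ((i : ℕ) : ℤ)) a)
      (h.sum_mul_mul_nonneg (fun i : Fin n => ((i : ℕ) : ℤ)) b)

theorem exists_subseq_fejerMean_tendsto_ae (hρ : Summable fun k => ρ k ^ 2) :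
    ∃ ns : ℕ → ℕ, ∀ᵐ t ∂(AddCircle.haarAddCircle (T := 2 * Real.pi)),
      Tendsto (fun i => fejerMean ρ (ns i) t) atTop (𝓝 (g₁ ρ t)) := by
  obtain ⟨ns, -, h⟩ := (tendstoInMeasure_of_tendsto_eLpNorm (by norm_num)
    (fun n => (memLp_fejerMean n 2).1) (Lp.memLp (g₁ ρ)).1
    (tendsto_eLpNorm_fejerMean_sub hρ)).exists_seq_tendsto_ae
  exact ⟨ns, h⟩

theorem IsStationaryGaussianSeq.g₁_im_re {Ω : Type*} [MeasurableSpace Ω] {P : Measure Ω}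
    [IsProbabilityMeasure P] {X : ℤ → Ω → ℝ} (h : IsStationaryGaussianSeq P X ρ)
    (hρ : Summable fun k => ρ k ^ 2) : ∀ᵐ t ∂(AddCircle.haarAddCircle (T := 2 * Real.pi)),
      (g₁ ρ t).im = 0 ∧ 0 ≤ (g₁ ρ t).re := by
  obtain ⟨ns, hns⟩ := exists_subseq_fejerMean_tendsto_ae hρ
  filter_upwards [hns] with t ht
  refine ⟨?_, ?_⟩
  · have := (Complex.continuous_im.tendsto _).comp ht
    refine tendsto_nhds_unique this ?_
    simp only [Function.comp_def, (h.fejerMean_im_re _ t).1]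
    exact tendsto_const_nhds
  · exact ge_of_tendsto' ((Complex.continuous_re.tendsto _).comp ht)
      fun i => (h.fejerMean_im_re _ t).2

/-- The coefficients of the Fejér mean are dominated by `|ρ|`, hence so are their self-convolutions
by that of `|ρ|`. The bound does not depend on `n`. -/
theorem integral_norm_fejerMean_pow_four_le (hρ : Summable fun k => ρ k ^ 2)
    (hc : Summable fun p => |cycleTerm ρ p|) (n : ℕ) :
    ∫ t, ‖fejerMean ρ n t‖ ^ 4 ∂AddCircle.haarAddCircle ≤ ∑' p, |cycleTerm ρ p| := by
  have h2 : MemLp (fun t => fejerMean ρ n t ^ 2) 2 AddCircle.haarAddCircle :=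
    ((continuous_fejerMean n).pow 2).memLp_of_hasCompactSupport
      (HasCompactSupport.of_compactSpace _)
  have hS := hasSum_sq_norm_tsum_fourierCoeff (memLp_fejerMean (ρ := ρ) n 2) h2
  have habs : Summable fun k => |ρ k| ^ 2 := by simpa only [sq_abs] using hρ
  have hA := hasSum_sq_tsum_mul_sub habs (by simpa only [cycleTerm_abs, abs_abs] using hc)
  simp only [cycleTerm_abs] at hA
  refine hasSum_le (fun k => ?_) hS hA
  refine pow_le_pow_left₀ (norm_nonneg _) ?_ 2
  refine tsum_of_norm_bounded (summable_mul_sub habs k).hasSum fun m => ?_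
  rw [norm_mul]
  exact mul_le_mul (norm_fourierCoeff_fejerMean_le _ _) (norm_fourierCoeff_fejerMean_le _ _)
    (norm_nonneg _) (abs_nonneg _)

/-- Fatou along an almost everywhere convergent subsequence of Fejér means, whose `L⁴` norms are
uniformly bounded. -/
theorem memLp_g₁_sq (hρ : Summable fun k => ρ k ^ 2) (hc : Summable fun p => |cycleTerm ρ p|) :
    MemLp (fun t => g₁ ρ t ^ 2) 2 AddCircle.haarAddCircle := by
  obtain ⟨ns, hns⟩ := exists_subseq_fejerMean_tendsto_ae hρ
  have hmeas : AEStronglyMeasurable (fun t => g₁ ρ t ^ 2) AddCircle.haarAddCircle :=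
    (Lp.memLp (g₁ ρ)).1.pow 2
  refine ⟨hmeas, lt_of_le_of_lt (Lp.eLpNorm_le_of_ae_tendsto (u := atTop)
    (f := fun i t => fejerMean ρ (ns i) t ^ 2)
    (C := ENNReal.ofReal (√(∑' p, |cycleTerm ρ p|))) ?_ ?_ ?_) ENNReal.ofReal_lt_top⟩
  · refine Eventually.of_forall fun i => ?_
    have h2 : MemLp (fun t => fejerMean ρ (ns i) t ^ 2) 2 AddCircle.haarAddCircle :=
      ((continuous_fejerMean _).pow 2).memLp_of_hasCompactSupport
        (HasCompactSupport.of_compactSpace _)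
    rw [h2.eLpNorm_eq_integral_rpow_norm (by norm_num) (by norm_num), Real.sqrt_eq_rpow]
    have := integral_norm_fejerMean_pow_four_le hρ hc (ns i)
    refine ENNReal.ofReal_le_ofReal ?_
    norm_num [← pow_mul]
    exact Real.rpow_le_rpow (by positivity) this (by norm_num)
  · exact fun i => ((continuous_fejerMean _).pow 2).aestronglyMeasurable
  · filter_upwards [hns] with t ht using ht.pow 2

theorem integral_norm_g₁_sq (hρ : Summable fun k => ρ k ^ 2) :
    ∫ t, ‖g₁ ρ t‖ ^ 2 ∂AddCircle.haarAddCircle = ∑' k, ρ k ^ 2 := by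
  have := (hasSum_sq_fourierCoeff (g₁ ρ)).tsum_eq
  simpa [fourierCoeff_g₁ hρ] using this.symm

theorem integral_norm_g₁_pow_four (hρ : Summable fun k => ρ k ^ 2)
    (hc : Summable fun p => |cycleTerm ρ p|) :
    ∫ t, ‖g₁ ρ t‖ ^ 4 ∂AddCircle.haarAddCircle = ∑' p, cycleTerm ρ p := by
  have h := hasSum_sq_norm_tsum_fourierCoeff (Lp.memLp (g₁ ρ)) (memLp_g₁_sq hρ hc)
  refine h.unique ?_
  have e : ∀ k, ‖∑' m, fourierCoeff (g₁ ρ) m * fourierCoeff (g₁ ρ) (k - m)‖ ^ 2 =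
      (∑' m, ρ m * ρ (k - m)) ^ 2 := by
    intro k
    simp only [fourierCoeff_g₁ hρ]
    norm_cast
    rw [Real.norm_eq_abs, sq_abs]
  simpa only [e] using hasSum_sq_tsum_mul_sub hρ hc

theorem ae_volume_of_ae_haar {p : Torus → Prop}
    (h : ∀ᵐ t ∂(AddCircle.haarAddCircle (T := 2 * Real.pi)), p t) : ∀ᵐ t : Torus, p t := by
  rw [AddCircle.volume_eq_smul_haarAddCircle]
  exact Measure.ae_smul_measure h _

theorem integral_volume_eq_haar (f : Torus → ℝ) :
    ∫ t, f t = 2 * Real.pi * ∫ t, f t ∂AddCircle.haarAddCircle := by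
  rw [AddCircle.integral_haarAddCircle, smul_eq_mul, mul_inv_cancel_left₀ Real.two_pi_pos.ne']

theorem norm_pow_eq_re_pow {z : ℂ} (h : z.im = 0 ∧ 0 ≤ z.re) (n : ℕ) : ‖z‖ ^ n = z.re ^ n := by
  have : z = (z.re : ℂ) := Complex.ext rfl (by simpa using h.1)
  rw [this, Complex.norm_real, Real.norm_of_nonneg h.2, Complex.ofReal_re]

theorem IsStationaryGaussianSeq.tsum_sq_pos {Ω : Type*} [MeasurableSpace Ω]
    {P : Measure Ω} {X : ℤ → Ω → ℝ} (h : IsStationaryGaussianSeq P X ρ)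
    (hρ : Summable fun k => ρ k ^ 2) : 0 < ∑' k, ρ k ^ 2 :=
  hρ.tsum_pos (fun _ => sq_nonneg _) 0 (by rw [h.unit_variance]; norm_num)

variable {Ω : Type*} [MeasurableSpace Ω] {P : Measure Ω} [IsProbabilityMeasure P]
  {X : ℤ → Ω → ℝ}

theorem IsStationaryGaussianSeq.integral_re_g₁_sq (h : IsStationaryGaussianSeq P X ρ)
    (hρ : Summable fun k => ρ k ^ 2) :
    ∫ t : Torus, (g₁ ρ t).re ^ 2 = 2 * Real.pi * ∑' k, ρ k ^ 2 := by
  rw [integral_volume_eq_haar, ← integral_norm_g₁_sq hρ]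
  congr 1
  refine integral_congr_ae ?_
  filter_upwards [h.g₁_im_re hρ] with t ht using (norm_pow_eq_re_pow ht 2).symm

theorem IsStationaryGaussianSeq.integral_re_g₁_pow_four (h : IsStationaryGaussianSeq P X ρ)
    (hρ : Summable fun k => ρ k ^ 2) (hc : Summable fun p => |cycleTerm ρ p|) :
    ∫ t : Torus, (g₁ ρ t).re ^ 4 = 2 * Real.pi * ∑' p, cycleTerm ρ p := by
  rw [integral_volume_eq_haar, ← integral_norm_g₁_pow_four hρ hc]
  congr 1
  refine integral_congr_ae ?_
  filter_upwards [h.g₁_im_re hρ] with t ht using (norm_pow_eq_re_pow ht 4).symm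

theorem IsStationaryGaussianSeq.integrable_re_g₁_pow_four (h : IsStationaryGaussianSeq P X ρ)
    (hρ : Summable fun k => ρ k ^ 2) (hc : Summable fun p => |cycleTerm ρ p|) :
    Integrable fun t : Torus => (g₁ ρ t).re ^ 4 := by
  rw [AddCircle.volume_eq_smul_haarAddCircle]
  refine Integrable.smul_measure ?_ ENNReal.ofReal_ne_top
  refine ((memLp_g₁_sq hρ hc).integrable_norm_pow (by norm_num)).congr ?_
  filter_upwards [h.g₁_im_re hρ] with t ht
  rw [norm_pow, ← pow_mul, norm_pow_eq_re_pow ht]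

end SpectralDensity

end BreuerMajor

/-! ### Assembly of the bounds and the limit. -/

theorem proposition5p3 (q : ℕ) (hq : 2 ≤ q) :
    ∃ C : ℝ, 0 < C ∧
      ∀ {Ω : Type*} [MeasurableSpace Ω] (P : Measure Ω) [IsProbabilityMeasure P]
        (X : ℤ → Ω → ℝ) (ρ : ℤ → ℝ),
        BreuerMajor.IsStationaryGaussianSeq P X ρ →
        Memℓp ρ (q : ℝ≥0∞) →
        -- the normalisation `F_n = V_n / √v_n` makes sense
        (∀ n : ℕ, 1 ≤ n → 0 < BreuerMajor.v q P X n) ∧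
        -- upper bounds on the fourth cumulant
        (∀ n : ℕ, 1 ≤ n →
          (q ≤ 3 →
            BreuerMajor.cumulant P (BreuerMajor.F q P X n) 4 ≤
              C / ((BreuerMajor.v q P X n) ^ 2 * n) *
                (∑ k ∈ Finset.Ioo (-(n : ℤ)) (n : ℤ), |ρ k| ^ (2 * (q : ℝ) / 3)) ^ 3) ∧
          (3 ≤ q →
            BreuerMajor.cumulant P (BreuerMajor.F q P X n) 4 ≤
              C / ((BreuerMajor.v q P X n) ^ 2 * n) *
                (∑ k ∈ Finset.Ioo (-(n : ℤ)) (n : ℤ), |ρ k| ^ (q - 1)) ^ 2 *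
                (∑ k ∈ Finset.Ioo (-(n : ℤ)) (n : ℤ), |ρ k| ^ 2))) ∧
        -- the limit for `q = 2`; `g₁` is a convergent series in `L²`, real and nonnegative a.e.
        (q = 2 → Memℓp ρ (4 / 3 : ℝ≥0∞) →
          Summable (BreuerMajor.spectralTerm ρ) ∧
          (∀ᵐ t : BreuerMajor.Torus,
            (BreuerMajor.g₁ ρ t).im = 0 ∧ 0 ≤ (BreuerMajor.g₁ ρ t).re) ∧
          0 < ∫ t : BreuerMajor.Torus, (BreuerMajor.g₁ ρ t).re ^ 2 ∧
          Integrable (fun t : BreuerMajor.Torus => (BreuerMajor.g₁ ρ t).re ^ 4) ∧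
          Tendsto (fun n : ℕ => (n : ℝ) * BreuerMajor.cumulant P (BreuerMajor.F q P X n) 4) atTop
            (𝓝 (24 * Real.pi *
              ((∫ t : BreuerMajor.Torus, (BreuerMajor.g₁ ρ t).re ^ 4) /
                (∫ t : BreuerMajor.Torus, (BreuerMajor.g₁ ρ t).re ^ 2) ^ 2)))) ∧
        -- the lower bound for `q ≥ 3`
        (3 ≤ q → Memℓp ρ (2 : ℝ≥0∞) →
          (0 : EReal) < liminf
            (fun n : ℕ =>
              (((n : ℝ) * BreuerMajor.cumulant P (BreuerMajor.F q P X n) 4 : ℝ) : EReal))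
            atTop) := by
  obtain ⟨C, hC, hbound⟩ := BreuerMajor.IsStationaryGaussianSeq.exists_cumulant_F_le hq
  refine ⟨C, hC, ?_⟩
  intro Ω _ P _ X ρ h hρ
  have hq0 : q ≠ 0 := by omega
  have hlim : Tendsto ρ cofinite (𝓝 0) := by
    rw [memℓp_gen_iff (by simpa using Nat.pos_of_ne_zero hq0)] at hρ
    have h0 : Tendsto (fun k => |ρ k| ^ q) cofinite (𝓝 0) := by
      simpa using hρ.tendsto_cofinite_zero
    have h1 : Tendsto (fun k => (|ρ k| ^ q) ^ ((q : ℝ)⁻¹)) cofinite (𝓝 (0 ^ ((q : ℝ)⁻¹))) :=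
      h0.rpow_const (Or.inr (by positivity))
    rw [Real.zero_rpow (by positivity)] at h1
    refine (tendsto_zero_iff_abs_tendsto_zero ρ).mpr (h1.congr fun k => ?_)
    exact Real.pow_rpow_inv_natCast (abs_nonneg _) hq0
  have hv : ∀ n : ℕ, 1 ≤ n → 0 < BreuerMajor.v q P X n := fun n hn => h.v_pos hq0 hlim hn
  refine ⟨hv, fun n hn => hbound P X ρ h n (hv n hn), ?_, ?_⟩
  · rintro rfl hρ'
    have hρ2 : Summable fun k => ρ k ^ 2 := by
      rw [memℓp_gen_iff (by norm_num)] at hρ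
      simpa using hρ
    have hρ43 : Summable fun k => |ρ k| ^ (4 / 3 : ℝ) := by
      rw [memℓp_gen_iff (by rw [ENNReal.toReal_div]; norm_num)] at hρ'
      simpa [ENNReal.toReal_div] using hρ'
    have hc := BreuerMajor.summable_abs_cycleTerm h.neg hρ43
    have hpos := h.tsum_sq_pos hρ2
    refine ⟨BreuerMajor.summable_spectralTerm hρ2,
      BreuerMajor.ae_volume_of_ae_haar (h.g₁_im_re hρ2), ?_,
      h.integrable_re_g₁_pow_four hρ2 hc, ?_⟩
    · rw [h.integral_re_g₁_sq hρ2]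
      exact mul_pos Real.two_pi_pos hpos
    · rw [h.integral_re_g₁_sq hρ2, h.integral_re_g₁_pow_four hρ2 hc]
      -- With `S` the cycle sum and `σ = ∑ ρ²`, the factors `2π` from Lebesgue measure give `24π *
      -- 2πS / (2πσ)² = 12 S / σ²`.
      convert h.tendsto_mul_cumulant_F_two hρ43 hρ2 hv hpos using 2
      have := Real.pi_pos.ne'
      field_simp
      ring
  · intro _ _
    have hc : 0 < diagramCoeff q 0 1 (q - 1) / (q.factorial : ℝ) ^ 2 := by
      have := diagramCoeff_pos q 0 1 (q - 1)
      positivity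
    refine lt_of_lt_of_le (EReal.coe_pos.mpr hc) (le_liminf_of_le (by isBoundedDefault) ?_)
    filter_upwards [eventually_ge_atTop 1] with n hn
    exact EReal.coe_le_coe_iff.mpr (h.le_mul_cumulant_F hq hn (hv n hn))
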